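/- Theorem (communication-limited uniformity testing with private coins). Let $k\ge 1$ and $\ell\ge 0$ be integers, and let $\mathcal W_\ell$ be the family of all channels $W$ from $[k]=\{1,\dots,k\}$ to $\{0,1\}^\ell$, i.e. of all families $(W(\cdot\mid x))_{x\in[k]}$ of probability distributions on $\{0,1\}^\ell$. In a private-coin protocol with $n$ players using $\mathcal W_\ell$, player $i$ holds one sample $X_i$, where $X_1,\dots,X_n$ are independent draws from an unknown distribution $p$ on $[k]$. Player $i$ selects a channel $W_i\in\mathcal W_\ell$ as a function of a private random variable $U_i$ ($U_1,\dots,U_n$ are independent, and independent of the samples), and sends to a referee the message $Y_i\sim W_i(\cdot\mid X_i)$; given the channels and the samples, the messages are independent. The referee sees $Y_1,\dots,Y_n$, but not $U_1,\dots,U_n$, and outputs a possibly randomized bit $T(Y_1,\dots,Y_n)\in\{0,1\}$. Such a protocol with $T$ is an $(n,\varepsilon)$-test of uniformity if $\Pr[T=1]>11/12$ when $p$ is the uniform distribution $u$ on $[k]$, and $\Pr[T=0]>11/12$ for every $p$ with $d_{TV}(p,u)>\varepsilon$, where $d_{TV}(p,u)=\frac12\sum_x|p(x)-u(x)|$. Let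 $n^*(k,\ell,\varepsilon)\in\mathbb N\cup\{\infty\}$ be the least $n$ for which an $(n,\varepsilon)$-test exists ($\infty$ if there is none). Then for every $\varepsilon_1<1$ there is a constant $c>0$, depending only on $\varepsilon_1$, such that for all $k\ge1$, all $\ell\ge 0$ and all $\varepsilon$ with $0<\varepsilon\le\varepsilon_1$ and $\varepsilon<1-\frac1k$, \[ n^*(k,\ell,\varepsilon)\;\ge\; c\cdot\frac{k^{3/2}}{2^\ell\,\varepsilon^2}. \] That is, $(k,\varepsilon)$-uniformity testing using $\mathcal W_\ell$ with private-coin protocols requires $\Omega\big(k^{3/2}/(2^\ell\varepsilon^2)\big)$ samples. -/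

import Mathlib

open MeasureTheory

universe u

namespace DistTesting

/-- Probability distributions on `[k]`. -/
abbrev Dist (k : ℕ) : Type := stdSimplex ℝ (Fin k)

/-- Total variation distance, half of the `ℓ¹` distance. -/
noncomputable def tvDist {k : ℕ} (p q : Dist k) : ℝ :=
  (1 / 2) * ∑ x, |p x - q x|

/-- Channels from `[k]` to the finite alphabet `Y`: `W x y` is `W(y ∣ x)`. -/
abbrev Channel (k : ℕ) (Y : Type) [Fintype Y] : Type := Fin k → stdSimplex ℝ Y

/-- The probability `∑ₓ p(x) W(y ∣ x)` that the channel outputs `y` on an input drawn from `p`. -/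
noncomputable def Channel.output {k : ℕ} {Y : Type} [Fintype Y] (W : Channel k Y)
    (p : Dist k) (y : Y) : ℝ :=
  ∑ x, p x * W x y

/-- The family of all channels from `[k]` to `{0,1}^ℓ`. -/
def bitChannels (k ℓ : ℕ) : Set (Channel k (Fin ℓ → Bool)) := Set.univ

/-- A private-coin simultaneous-message-passing protocol with `n` players using channels in `𝒲`:
player `i` draws a private coin from its own probability space, independently of everything
else, and selects its channel as a function of that coin. -/
structure PrivateCoinProtocol {k : ℕ} {Y : Type} [Fintype Y] (𝒲 : Set (Channel k Y))
    (n : ℕ) where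
  /-- the space of values of the coin of player `i` -/
  Coin : Fin n → Type u
  /-- the σ-algebra on it -/
  measurableSpace : ∀ i, MeasurableSpace (Coin i)
  /-- the law of the coin of player `i` -/
  law : ∀ i, Measure (Coin i)
  isProbabilityMeasure : ∀ i, IsProbabilityMeasure (law i)
  /-- the channel that player `i` selects, given its coin -/
  channel : ∀ i, Coin i → Channel k Y
  measurable_channel : ∀ i, Measurable (channel i)
  channel_mem : ∀ i c, channel i c ∈ 𝒲

attribute [instance] PrivateCoinProtocol.measurableSpace
  PrivateCoinProtocol.isProbabilityMeasure

/-- The probability that the messages are `y = (y₁, …, yₙ)` when the players hold independent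
samples from `p`. The coins are independent (product measure), and, given the coins, so are the
outputs of the selected channels. -/
noncomputable def PrivateCoinProtocol.messageProb {k : ℕ} {Y : Type} [Fintype Y]
    {𝒲 : Set (Channel k Y)} {n : ℕ} (P : PrivateCoinProtocol.{u} 𝒲 n)
    (p : Dist k) (y : Fin n → Y) : ℝ :=
  ∫ c, ∏ i, (P.channel i (c i)).output p (y i) ∂(Measure.pi P.law)

/-- A randomized test of the referee sees the messages only (not the coins): `T y` is the
probability that it outputs `1` on the messages `y`. This is the probability that it
outputs `1` when the players hold independent samples from `p`. -/
noncomputable def PrivateCoinProtocol.probOne {k : ℕ} {Y : Type} [Fintype Y]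
    {𝒲 : Set (Channel k Y)} {n : ℕ} (P : PrivateCoinProtocol.{u} 𝒲 n)
    (T : (Fin n → Y) → Set.Icc (0 : ℝ) 1) (p : Dist k) : ℝ :=
  ∑ y, P.messageProb p y * (T y : ℝ)

/-- The probability that the referee outputs `0` when the players hold independent samples
from `p`. -/
noncomputable def PrivateCoinProtocol.probZero {k : ℕ} {Y : Type} [Fintype Y]
    {𝒲 : Set (Channel k Y)} {n : ℕ} (P : PrivateCoinProtocol.{u} 𝒲 n)
    (T : (Fin n → Y) → Set.Icc (0 : ℝ) 1) (p : Dist k) : ℝ :=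
  ∑ y, P.messageProb p y * (1 - (T y : ℝ))

/-- `(P, T)` is an `(n, ε)`-test for identity to the reference distribution `q`. -/
def PrivateCoinProtocol.IsIdentityTest {k : ℕ} {Y : Type} [Fintype Y]
    {𝒲 : Set (Channel k Y)} {n : ℕ} (P : PrivateCoinProtocol.{u} 𝒲 n)
    (T : (Fin n → Y) → Set.Icc (0 : ℝ) 1) (q : Dist k) (ε : ℝ) : Prop :=
  11 / 12 < P.probOne T q ∧ ∀ p : Dist k, ε < tvDist p q → 11 / 12 < P.probZero T p

/-- The sample complexity of `(k, ε)`-identity testing with reference `q` using `𝒲` for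
private-coin protocols: the least `n` for which there is an `(n, ε)`-test (`⊤` if there is
none). -/
noncomputable def privateCoinIdentitySampleComplexity {k : ℕ} {Y : Type} [Fintype Y]
    (𝒲 : Set (Channel k Y)) (q : Dist k) (ε : ℝ) : ℕ∞ :=
  ⨅ n ∈ {n : ℕ | ∃ (P : PrivateCoinProtocol.{u} 𝒲 n) (T : (Fin n → Y) → Set.Icc (0 : ℝ) 1),
    P.IsIdentityTest T q ε}, (n : ℕ∞)

/-- The uniform distribution on `[k]`. -/
noncomputable def uniform (k : ℕ) [NeZero k] : Dist k :=
  ⟨fun _ => 1 / (k : ℝ), fun _ => by positivity, by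
    have : (k : ℝ) ≠ 0 := Nat.cast_ne_zero.mpr (NeZero.ne k)
    simp [this]⟩

/-- The sample complexity of `(k, ε)`-uniformity testing using `𝒲` for private-coin
protocols. -/
noncomputable def privateCoinUniformitySampleComplexity {k : ℕ} [NeZero k] {Y : Type}
    [Fintype Y] (𝒲 : Set (Channel k Y)) (ε : ℝ) : ℕ∞ :=
  privateCoinIdentitySampleComplexity.{u} 𝒲 (uniform k) ε

end DistTesting

/-! The referee does not see the coins and the coins are independent, so each player may be replaced
by its averaged channel: the messages form a product distribution depending only on `avgChannel`
(`messageProb_eq_prod`). The alternatives may therefore be chosen after these channels. A test gives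
a lower bound on the χ²-divergence from uniform of any mixture of far distributions
(`IsIdentityTest.lt_chiSq_mixture`), so it suffices to build a mixture that few players cannot
detect.

For densities proportional to `1 + s f`, the χ² quantity is at most the mean of `exp (C ⟪R, R'⟫)`,
where `R = ∑ f(x) r(x)`, `R'` is an independent copy of `R`, `r(x)` is the vector of normalized
deviations of all channels at `x` (`influence`), and `C` is of order `s²`. The squared norms of the
`r(x)` sum to at most `n 2^ℓ / k`. Independent choices of `f(x)` can correlate badly with the
channels; the Gram–Schmidt walk (`exists_subgaussian_rounding`) instead rounds so that a signed sum
of vectors of norm at most 1 is sub-Gaussian with constant variance proxy in every direction.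
Rescale so that most `r(x)` have norm of order 1. Then `‖R‖²` is of order `k`, `⟪R, R'⟫` is of order
`√k`, and detection forces `n 2^ℓ ε² / k² ≳ 1 / √k`, the claimed bound.

To reach every `ε₁ < 1`, `f` is very asymmetric: it equals `-1` on most points and `1/a - 1` on a
fraction of about `a`, which makes the distance nearly `s` (`exists_hard_family`, `lt_tvDist_tilt`).
Domains of bounded size are handled by a single spiked alternative (`IsIdentityTest.lt_mul_sq`). -/

namespace DistTesting

/-! ### Orthogonal projections and how residuals change with the subspace. -/

section Projection

variable {E : Type*} [NormedAddCommGroup E] [InnerProductSpace ℝ E] [FiniteDimensional ℝ E]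

lemma norm_sub_starProjection_sq (U : Submodule ℝ E) (y : E) :
    ‖y - U.starProjection y‖ ^ 2 = ‖y‖ ^ 2 - ‖U.starProjection y‖ ^ 2 := by
  have h := U.starProjection_inner_eq_zero y _ (U.starProjection_apply_mem y)
  have h2 := norm_add_sq_real (y - U.starProjection y) (U.starProjection y)
  rw [h, sub_add_cancel] at h2
  linarith

lemma sq_inner_le_starProjection_gain {U' U : Submodule ℝ E} (h : U' ≤ U) {f : E} (hf : f ∈ U)
    (hf' : f ∈ U'ᗮ) (θ : E) :
    inner ℝ f θ ^ 2 ≤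
      ‖f‖ ^ 2 * (‖U.starProjection θ‖ ^ 2 - ‖U'.starProjection θ‖ ^ 2) := by
  set y := U.starProjection θ with hy
  have h1 : inner ℝ f θ = inner ℝ f y := by
    have := U.starProjection_inner_eq_zero θ f hf
    rw [inner_sub_left, sub_eq_zero] at this
    rw [real_inner_comm, this, real_inner_comm]
  have h2 : inner ℝ f y = inner ℝ f (y - U'.starProjection y) := by
    rw [inner_sub_right, real_inner_comm (U'.starProjection y) f,
      hf' _ (U'.starProjection_apply_mem y), sub_zero]
  have h3 : U'.starProjection θ = U'.starProjection y := by
    rw [hy, ← ContinuousLinearMap.comp_apply,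
      Submodule.starProjection_comp_starProjection_of_le h]
  rw [h1, h2, h3, ← norm_sub_starProjection_sq, ← mul_pow]
  exact sq_le_sq' (neg_le_of_abs_le (abs_real_inner_le_norm _ _)) (real_inner_le_norm _ _)

lemma norm_starProjection_mono {U' U : Submodule ℝ E} (h : U' ≤ U) (θ : E) :
    ‖U'.starProjection θ‖ ^ 2 ≤ ‖U.starProjection θ‖ ^ 2 := by
  have h3 : U'.starProjection θ = U'.starProjection (U.starProjection θ) := by
    rw [← ContinuousLinearMap.comp_apply,
      Submodule.starProjection_comp_starProjection_of_le h]
  rw [h3]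
  have := U'.norm_starProjection_apply_le (U.starProjection θ)
  gcongr

/-- The component of `b` orthogonal to `V`. -/
noncomputable def perp (V : Submodule ℝ E) (b : E) : E := b - V.starProjection b

lemma perp_mem_orthogonal (V : Submodule ℝ E) (b : E) : perp V b ∈ Vᗮ :=
  V.sub_starProjection_mem_orthogonal b

lemma inner_perp_self (V : Submodule ℝ E) (b : E) : inner ℝ (perp V b) b = ‖perp V b‖ ^ 2 := by
  have h := V.starProjection_inner_eq_zero b _ (V.starProjection_apply_mem b)
  rw [← real_inner_self_eq_norm_sq]
  conv_rhs => rw [perp]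
  rw [perp, inner_sub_right _ b, h, sub_zero]

lemma norm_perp_le (V : Submodule ℝ E) (b : E) : ‖perp V b‖ ≤ ‖b‖ := by
  have := norm_sub_starProjection_sq V b
  refine abs_le_of_sq_le_sq' ?_ (norm_nonneg _) |>.2
  rw [perp, this]
  nlinarith [sq_nonneg ‖V.starProjection b‖]

lemma perp_mem {V U : Submodule ℝ E} (h : V ≤ U) {b : E} (hb : b ∈ U) : perp V b ∈ U :=
  U.sub_mem hb (h (V.starProjection_apply_mem b))

lemma add_sq_inner_perp_le {V U : Submodule ℝ E} (h : V ≤ U) {b : E} (hb : b ∈ U)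
    (hb1 : ‖b‖ ≤ 1) (θ : E) :
    ‖V.starProjection θ‖ ^ 2 + inner ℝ (perp V b) θ ^ 2 ≤ ‖U.starProjection θ‖ ^ 2 := by
  have h1 := sq_inner_le_starProjection_gain h (perp_mem h hb) (perp_mem_orthogonal V b) θ
  have h2 := norm_starProjection_mono h θ
  have h3 : ‖perp V b‖ ^ 2 ≤ 1 := by
    have := (norm_perp_le V b).trans hb1
    have := norm_nonneg (perp V b)
    nlinarith
  nlinarith

/-- The form `(g - σ g')² - σ (1 - σ) (g² - g'²)` is positive semidefinite; `key` completes the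
square after multiplication by the coefficient `1 - σ + σ²` of `g²`. -/
lemma sq_sub_sq_le_of_sq_sub_mul_le {g g' σ L : ℝ} (h0 : 0 ≤ σ) (h1 : σ ≤ 1)
    (h : (g - σ * g') ^ 2 ≤ σ * (1 - σ) * L) : g ^ 2 - g' ^ 2 ≤ max L 0 := by
  rcases h0.eq_or_lt with rfl | h0
  · have : g = 0 := by nlinarith
    subst this
    exact le_max_of_le_right (by nlinarith [sq_nonneg g'])
  rcases h1.eq_or_lt with rfl | h1
  · have : g = g' := by nlinarith
    subst this
    simp
  have hp : 0 < σ * (1 - σ) := mul_pos h0 (by linarith)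
  refine le_max_of_le_left (le_of_mul_le_mul_left (le_trans ?_ h) hp)
  have key : 0 ≤ (g * (1 - σ + σ ^ 2) - σ * g') ^ 2 + σ * (1 - σ) ^ 2 * g' ^ 2 := by positivity
  have hq : 0 < 1 - σ + σ ^ 2 := by nlinarith
  have : 0 ≤ (1 - σ + σ ^ 2) * ((g - σ * g') ^ 2 - σ * (1 - σ) * (g ^ 2 - g' ^ 2)) := by
    nlinarith [key]
  nlinarith [nonneg_of_mul_nonneg_right this hq]

/-- Removing vectors from the span costs at most the loss of projected length. -/
lemma sq_inner_perp_sub_le {V V' : Submodule ℝ E} (h : V' ≤ V) {b : E} (hb1 : ‖b‖ ≤ 1) (θ : E) :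
    inner ℝ (perp V b) θ ^ 2 - inner ℝ (perp V' b) θ ^ 2 ≤
      ‖(V ⊔ ℝ ∙ b).starProjection θ‖ ^ 2 - ‖(V' ⊔ ℝ ∙ b).starProjection θ‖ ^ 2 := by
  set U := V ⊔ ℝ ∙ b
  set U' := V' ⊔ ℝ ∙ b
  have hU : U' ≤ U := sup_le_sup_right h _
  have hbU : b ∈ U := (le_sup_right : ℝ ∙ b ≤ U) (Submodule.mem_span_singleton_self b)
  have hVU : V ≤ U := le_sup_left
  set e := perp V b
  set e' := perp V' b
  have hmono := norm_starProjection_mono hU θ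
  have hρ : ‖e‖ ^ 2 ≤ ‖e'‖ ^ 2 := by
    have := norm_starProjection_mono h b
    simp only [e, e', perp, norm_sub_starProjection_sq]
    linarith
  have hρ1 : ‖e'‖ ^ 2 ≤ 1 := by
    have := (norm_perp_le V' b).trans hb1
    have := norm_nonneg (perp V' b)
    nlinarith
  rcases (sq_nonneg ‖e'‖).eq_or_lt with h0 | h0
  · have : ‖e‖ ^ 2 = 0 := le_antisymm (hρ.trans h0.ge) (sq_nonneg _)
    have he : e = 0 := by simpa using this
    rw [he, inner_zero_left]
    nlinarith [sq_nonneg (inner ℝ e' θ)]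
  -- This `σ` makes `e - σ • e'` orthogonal to `b`, hence to all of `U'`, so its inner product with
  -- `θ` is controlled by the part of `θ` in `U` beyond `U'`.
  set σ := ‖e‖ ^ 2 / ‖e'‖ ^ 2
  have hσ : σ * ‖e'‖ ^ 2 = ‖e‖ ^ 2 := div_mul_cancel₀ _ h0.ne'
  have hσ0 : 0 ≤ σ := by positivity
  have hσ1 : σ ≤ 1 := div_le_one_of_le₀ hρ h0.le
  have heV' : e ∈ V'ᗮ := Submodule.orthogonal_le h (perp_mem_orthogonal V b)
  have he'V' : e' ∈ V'ᗮ := perp_mem_orthogonal V' b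
  have heb : inner ℝ e b = ‖e‖ ^ 2 := inner_perp_self V b
  have he'b : inner ℝ e' b = ‖e'‖ ^ 2 := inner_perp_self V' b
  have hf' : e - σ • e' ∈ U'ᗮ := by
    rw [← Submodule.inf_orthogonal]
    refine ⟨Submodule.sub_mem _ heV' (Submodule.smul_mem _ _ he'V'), ?_⟩
    refine Submodule.mem_orthogonal_singleton_iff_inner_right.2 ?_
    rw [real_inner_comm, inner_sub_left, inner_smul_left, heb, he'b]
    simp [hσ]
  have hf : e - σ • e' ∈ U :=
    U.sub_mem (perp_mem hVU hbU) (U.smul_mem _ (perp_mem (h.trans hVU) hbU))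
  have key := sq_inner_le_starProjection_gain hU hf hf' θ
  have hee' : inner ℝ e e' = ‖e‖ ^ 2 := by
    have : inner ℝ e (V'.starProjection b) = 0 := by
      rw [real_inner_comm]; exact heV' _ (V'.starProjection_apply_mem b)
    change inner ℝ e (b - V'.starProjection b) = _
    rw [inner_sub_right, heb, this, sub_zero]
  have hnorm : ‖e - σ • e'‖ ^ 2 = ‖e‖ ^ 2 * (1 - σ) := by
    rw [norm_sub_sq_real, inner_smul_right, hee', norm_smul, Real.norm_of_nonneg hσ0, mul_pow,
      sq σ, mul_assoc σ, hσ]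
    ring
  rw [hnorm, inner_sub_left, inner_smul_left] at key
  simp only [conj_trivial] at key
  have hle : ‖e‖ ^ 2 ≤ σ := by rw [← hσ]; exact mul_le_of_le_one_right hσ0 hρ1
  have := sq_sub_sq_le_of_sq_sub_mul_le hσ0 hσ1 (key.trans
    (mul_le_mul_of_nonneg_right (mul_le_mul_of_nonneg_right hle (sub_nonneg.2 hσ1))
      (sub_nonneg.2 hmono)))
  rwa [max_eq_left (sub_nonneg.2 hmono)] at this

end Projection

/-! ### The Gram–Schmidt walk and its exponential moments. -/

section Walk

lemma exists_step_to_boundary {ι : Type*} (A : Finset ι) (x u : ι → ℝ) {p : ι} (hp : p ∈ A)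
    (hu : |u p| = 1) (hx : ∀ i ∈ A, |x i| < 1) :
    ∃ δ : ℝ, 0 < δ ∧ (∀ i ∈ A, |x i + δ * u i| ≤ 1) ∧ ∃ i ∈ A, |x i + δ * u i| = 1 := by
  set f : ℝ → ℝ := fun δ => A.sup' ⟨p, hp⟩ fun i => |x i + δ * u i|
  have hf : Continuous f := by
    refine Continuous.finset_sup'_apply _ fun i _ => ?_
    fun_prop
  have h0 : f 0 < 1 := by
    refine (Finset.sup'_lt_iff _).2 fun i hi => ?_
    simpa using hx i hi
  -- A step of length 2 surely leaves the cube, because the pivot moves by 2 from a point of `(-1,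
  -- 1)`.
  have h2 : 1 ≤ f 2 := by
    refine le_trans ?_ (Finset.le_sup' (fun i => |x i + 2 * u i|) hp)
    have h1 := hx p hp
    have := abs_sub_abs_le_abs_sub (2 * u p) (-x p)
    rw [abs_mul, hu, abs_neg, sub_neg_eq_add, add_comm (2 * u p)] at this
    norm_num at this
    linarith
  obtain ⟨δ, hδ, hδ1⟩ := intermediate_value_Icc (by norm_num : (0 : ℝ) ≤ 2) hf.continuousOn
    ⟨h0.le, h2⟩
  obtain ⟨i, hi, hi1⟩ := Finset.exists_mem_eq_sup' ⟨p, hp⟩ fun i => |x i + δ * u i|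
  refine ⟨δ, ?_, fun j hj => ?_, i, hi, ?_⟩
  · rcases hδ.1.eq_or_lt with h | h
    · subst h; exact absurd hδ1 h0.ne
    · exact h
  · rw [← hδ1]; exact Finset.le_sup' (fun i => |x i + δ * u i|) hj
  · rw [← hi1]; exact hδ1

/-- By Jensen this makes the walk's potential a supermartingale. The second derivative has the sign
of `(1 - 4 t g)² - 4`, which is nonpositive as `|t g| ≤ 1/4`; hence the restriction `‖θ‖ ≤ 1/4`
throughout. -/
lemma concaveOn_exp_linear_sub_sq {g : ℝ} (hg : |g| ≤ 1 / 4) :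
    ConcaveOn ℝ (Set.Icc (-1) 1) fun t : ℝ => Real.exp (t * g - 2 * t ^ 2 * g ^ 2) := by
  have h1 : ∀ t : ℝ, HasDerivAt (fun t : ℝ => Real.exp (t * g - 2 * t ^ 2 * g ^ 2))
      (Real.exp (t * g - 2 * t ^ 2 * g ^ 2) * (g - 4 * t * g ^ 2)) t := by
    intro t
    refine HasDerivAt.exp ?_
    have a := (hasDerivAt_id t).mul_const g
    have b := (((hasDerivAt_pow 2 t).const_mul 2).mul_const (g ^ 2))
    refine (a.sub b).congr_deriv ?_
    change 1 * g - 2 * ((2 : ℕ) * t ^ 1) * g ^ 2 = _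
    push_cast; ring
  have h2 : ∀ t : ℝ, HasDerivAt
      (fun t : ℝ => Real.exp (t * g - 2 * t ^ 2 * g ^ 2) * (g - 4 * t * g ^ 2))
      (Real.exp (t * g - 2 * t ^ 2 * g ^ 2) * ((g - 4 * t * g ^ 2) ^ 2 - 4 * g ^ 2)) t := by
    intro t
    have c : HasDerivAt (fun t : ℝ => g - 4 * t * g ^ 2) (-(4 * g ^ 2)) t := by
      have := (((hasDerivAt_id t).const_mul 4).mul_const (g ^ 2)).const_sub g
      refine this.congr_deriv ?_
      simp
    refine ((h1 t).mul c).congr_deriv ?_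
    ring
  have d1 : deriv (fun t : ℝ => Real.exp (t * g - 2 * t ^ 2 * g ^ 2)) =
      fun t => Real.exp (t * g - 2 * t ^ 2 * g ^ 2) * (g - 4 * t * g ^ 2) :=
    funext fun t => (h1 t).deriv
  refine concaveOn_of_deriv2_nonpos (convex_Icc _ _)
    (fun t _ => (h1 t).continuousAt.continuousWithinAt)
    (fun t _ => (h1 t).differentiableAt.differentiableWithinAt) ?_ ?_
  · rw [d1]; exact fun t _ => (h2 t).differentiableAt.differentiableWithinAt
  · intro t ht
    rw [interior_Icc] at ht
    simp only [Function.iterate_succ, Function.iterate_zero, Function.comp, id]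
    rw [d1, (h2 t).deriv]
    refine mul_nonpos_of_nonneg_of_nonpos (Real.exp_pos _).le ?_
    have e : (g - 4 * t * g ^ 2) ^ 2 - 4 * g ^ 2 = g ^ 2 * ((1 - 4 * t * g) ^ 2 - 4) := by ring
    rw [e]
    refine mul_nonpos_of_nonneg_of_nonpos (sq_nonneg _) ?_
    have : |t * g| ≤ 1 / 4 := by
      rw [abs_mul]
      have : |t| ≤ 1 := abs_le.2 ⟨ht.1.le, ht.2.le⟩
      nlinarith [abs_nonneg t, abs_nonneg g]
    obtain ⟨h3, h4⟩ := abs_le.1 this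
    nlinarith

variable {E : Type*} [NormedAddCommGroup E] [InnerProductSpace ℝ E] [FiniteDimensional ℝ E]
variable {ι : Type*} [Fintype ι] [DecidableEq ι]

/-- There is a random rounding of the coordinates of `x` in `insert p S` to signs, such that
the error `∑ i, (Y i - x i) • b i` is sub-Gaussian, with a variance proxy that improves
as the pivot coordinate `x p` approaches a sign. -/
def HasRounding (b : ι → E) (p : ι) (S : Finset ι) (x : ι → ℝ) : Prop :=
  ∃ (Ω : Type) (_ : Fintype Ω) (w : Ω → ℝ) (Y : Ω → ι → ℝ),
    (∀ ω, 0 ≤ w ω) ∧ ∑ ω, w ω = 1 ∧ (∀ ω, ∀ i ∈ insert p S, |Y ω i| = 1) ∧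
    (∀ ω, ∀ i ∉ insert p S, Y ω i = x i) ∧
    ∀ θ : E, ‖θ‖ ≤ 1 / 4 →
      ∑ ω, w ω * Real.exp (inner ℝ (∑ i, (Y ω i - x i) • b i) θ) ≤
        Real.exp (2 * ‖(Submodule.span ℝ (b '' S) ⊔ ℝ ∙ b p).starProjection θ‖ ^ 2 -
          2 * x p ^ 2 * inner ℝ (perp (Submodule.span ℝ (b '' S)) (b p)) θ ^ 2)

/-- Freezing a coordinate never raises the potential. If the pivot freezes, then `x p ^ 2 = 1` and
the subtracted term pays for dropping `b p` from the span; any element of `S` becomes the new pivot.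
If another coordinate freezes, the pivot's residual changes, and `sq_inner_perp_sub_le` bounds the
change by the loss of projected length. -/
lemma hasRounding_of_abs_eq_one {b : ι → E} (hb : ∀ i, ‖b i‖ ≤ 1) {p : ι} {S : Finset ι}
    (hp : p ∉ S) {x : ι → ℝ} (hx : ∀ i, |x i| ≤ 1)
    (IH : ∀ q T, q ∉ T → T.card < S.card → HasRounding b q T x)
    {i : ι} (hi : i ∈ insert p S) (hi1 : |x i| = 1) : HasRounding b p S x := by
  rcases Finset.mem_insert.1 hi with rfl | hiS
  · have hx2 : x i ^ 2 = 1 := by rw [← sq_abs, hi1]; norm_num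
    have hVU (θ : E) := add_sq_inner_perp_le
      (le_sup_left : Submodule.span ℝ (b '' S) ≤ Submodule.span ℝ (b '' S) ⊔ ℝ ∙ b i)
      ((le_sup_right : ℝ ∙ b i ≤ Submodule.span ℝ (b '' S) ⊔ ℝ ∙ b i)
        (Submodule.mem_span_singleton_self _)) (hb i) θ
    rcases S.eq_empty_or_nonempty with rfl | ⟨q, hq⟩
    · refine ⟨Unit, inferInstance, fun _ => 1, fun _ => x, fun _ => zero_le_one, by simp, ?_,
        fun _ _ _ => rfl, fun θ _ => ?_⟩
      · simpa using hi1
      · simp only [sub_self, zero_smul, Finset.sum_const_zero, inner_zero_left, Real.exp_zero,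
          mul_one, Finset.univ_unique, Finset.sum_singleton]
        rw [hx2]
        refine Real.one_le_exp ?_
        nlinarith [hVU θ, sq_nonneg ‖(Submodule.span ℝ (b '' (∅ : Finset ι))).starProjection θ‖]
    · obtain ⟨Ω, hΩ, w, Y, hw, hw1, hY, hYx, hE⟩ := IH q (S.erase q) (Finset.notMem_erase _ _)
        (Finset.card_erase_lt_of_mem hq)
      rw [Finset.insert_erase hq] at hY hYx
      refine ⟨Ω, hΩ, w, Y, hw, hw1, fun ω j hj => ?_, fun ω j hj => ?_, fun θ hθ => ?_⟩
      · rcases Finset.mem_insert.1 hj with rfl | hj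
        · rw [hYx ω j hp, hi1]
        · exact hY ω j hj
      · exact hYx ω j fun h => hj (Finset.mem_insert_of_mem h)
      · refine (hE θ hθ).trans (Real.exp_le_exp.2 ?_)
        have hle : Submodule.span ℝ (b '' (S.erase q : Finset ι)) ⊔ ℝ ∙ b q ≤
            Submodule.span ℝ (b '' S) := by
          refine sup_le (Submodule.span_mono (Set.image_mono (by simp))) ?_
          rw [Submodule.span_singleton_le_iff_mem]
          exact Submodule.subset_span ⟨q, by simpa using hq, rfl⟩
        have := norm_starProjection_mono hle θ
        have := hVU θ
        rw [hx2]
        nlinarith [mul_nonneg (sq_nonneg (x q))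
          (sq_nonneg (inner ℝ (perp (Submodule.span ℝ (b '' (S.erase q : Finset ι))) (b q)) θ))]
  · obtain ⟨Ω, hΩ, w, Y, hw, hw1, hY, hYx, hE⟩ := IH p (S.erase i)
      (fun h => hp (Finset.mem_of_mem_erase h)) (Finset.card_erase_lt_of_mem hiS)
    have hpi : i ≠ p := fun h => hp (h ▸ hiS)
    refine ⟨Ω, hΩ, w, Y, hw, hw1, fun ω j hj => ?_, fun ω j hj => ?_, fun θ hθ => ?_⟩
    · by_cases hji : j = i
      · subst hji
        rw [hYx ω j (by simp [hpi]), hi1]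
      · refine hY ω j ?_
        simp only [Finset.mem_insert, Finset.mem_erase] at hj ⊢
        tauto
    · refine hYx ω j ?_
      simp only [Finset.mem_insert, Finset.mem_erase] at hj ⊢
      tauto
    · refine (hE θ hθ).trans (Real.exp_le_exp.2 ?_)
      have hle : Submodule.span ℝ (b '' (S.erase i : Finset ι)) ≤ Submodule.span ℝ (b '' S) :=
        Submodule.span_mono (Set.image_mono (by simp))
      have h1 := sq_inner_perp_sub_le hle (hb p) θ
      have h2 := norm_starProjection_mono (sup_le_sup_right hle (ℝ ∙ b p)) θ
      have h3 : x p ^ 2 ≤ 1 := by rw [← sq_abs]; nlinarith [hx p, abs_nonneg (x p)]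
      nlinarith [mul_nonneg (sq_nonneg (x p)) (sub_nonneg.2 h1),
        mul_nonneg (sub_nonneg.2 h3) (sub_nonneg.2 h2)]

/-- One martingale step along `±u`: the two outcomes get the weights that keep the mean at `x`. The
error moves along `perp` of the pivot vector, so only the scalar `g` enters, and concavity in the
pivot coordinate closes the estimate. -/
lemma hasRounding_step {b : ι → E} (hb : ∀ i, ‖b i‖ ≤ 1) {p : ι} {S : Finset ι}
    {x u : ι → ℝ} (hup : u p = 1)
    (hu : ∑ i, u i • b i = perp (Submodule.span ℝ (b '' S)) (b p))
    (hu0 : ∀ i ∉ insert p S, u i = 0) {δ δ' : ℝ} (hδ : 0 < δ) (hδ' : 0 < δ')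
    (h1 : HasRounding b p S fun i => x i + δ * u i)
    (h2 : HasRounding b p S fun i => x i + δ' * (-u i))
    (hx1 : |x p + δ| ≤ 1) (hx2 : |x p - δ'| ≤ 1) : HasRounding b p S x := by
  obtain ⟨Ω, hΩ, w, Y, hw, hw1, hY, hYx, hE⟩ := h1
  obtain ⟨Ω', hΩ', w', Y', hw', hw1', hY', hYx', hE'⟩ := h2
  have hs : 0 < δ + δ' := by linarith
  set a := δ' / (δ + δ')
  set a' := δ / (δ + δ')
  have ha : 0 ≤ a := by positivity
  have ha' : 0 ≤ a' := by positivity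
  have haa : a + a' = 1 := by simp only [a, a']; field_simp; ring
  refine ⟨Ω ⊕ Ω', inferInstance, Sum.elim (fun ω => a * w ω) fun ω => a' * w' ω, Sum.elim Y Y',
    ?_, ?_, ?_, ?_, fun θ hθ => ?_⟩
  · rintro (ω | ω)
    · exact mul_nonneg ha (hw ω)
    · exact mul_nonneg ha' (hw' ω)
  · simp [Fintype.sum_sum_type, ← Finset.mul_sum, hw1, hw1', haa]
  · rintro (ω | ω)
    · exact hY ω
    · exact hY' ω
  · rintro (ω | ω) i hi
    · simp [hYx ω i hi, hu0 i hi]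
    · simp [hYx' ω i hi, hu0 i hi]
  set e := perp (Submodule.span ℝ (b '' S)) (b p)
  set g := inner ℝ e θ
  set P := ‖(Submodule.span ℝ (b '' S) ⊔ ℝ ∙ b p).starProjection θ‖ ^ 2
  have hg : |g| ≤ 1 / 4 := by
    refine (abs_real_inner_le_norm _ _).trans ?_
    have := (norm_perp_le (Submodule.span ℝ (b '' S)) (b p)).trans (hb p)
    calc ‖e‖ * ‖θ‖ ≤ 1 * (1 / 4) := mul_le_mul this hθ (norm_nonneg _) zero_le_one
      _ = _ := one_mul _
  have hin : ∀ (Z : ι → ℝ) (d : ℝ), inner ℝ (∑ i, (Z i - x i) • b i) θ =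
      inner ℝ (∑ i, (Z i - (x i + d * u i)) • b i) θ + d * g := by
    intro Z d
    have : ∑ i, (Z i - x i) • b i = ∑ i, (Z i - (x i + d * u i)) • b i + d • e := by
      rw [← hu, Finset.smul_sum, ← Finset.sum_add_distrib]
      refine Finset.sum_congr rfl fun i _ => ?_
      module
    rw [this, inner_add_left, inner_smul_left]
    simp [g]
  have e1 := hE θ hθ
  have e2 := hE' θ hθ
  simp only [hup, mul_one] at e1 e2
  have c := (concaveOn_exp_linear_sub_sq hg).2 (abs_le.1 hx1) (abs_le.1 hx2) ha ha' haa
  have hmean : a • (x p + δ) + a' • (x p - δ') = x p := by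
    have : a * δ = a' * δ' := by simp only [a, a']; ring
    simp only [smul_eq_mul]
    linear_combination (x p) * haa + this
  rw [hmean] at c
  simp only [smul_eq_mul] at c
  simp only [Fintype.sum_sum_type, Sum.elim_inl, Sum.elim_inr]
  have f1 : ∑ ω, a * w ω * Real.exp (inner ℝ (∑ i, (Y ω i - x i) • b i) θ) =
      a * Real.exp (δ * g) *
        ∑ ω, w ω * Real.exp (inner ℝ (∑ i, (Y ω i - (x i + δ * u i)) • b i) θ) := by
    rw [Finset.mul_sum]
    refine Finset.sum_congr rfl fun ω _ => ?_
    rw [hin _ δ, Real.exp_add]; ring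
  have f2 : ∑ ω, a' * w' ω * Real.exp (inner ℝ (∑ i, (Y' ω i - x i) • b i) θ) =
      a' * Real.exp (-δ' * g) *
        ∑ ω, w' ω * Real.exp (inner ℝ (∑ i, (Y' ω i - (x i + δ' * (-u i))) • b i) θ) := by
    rw [Finset.mul_sum]
    refine Finset.sum_congr rfl fun ω _ => ?_
    rw [hin _ (-δ'), Real.exp_add]
    have : ∀ i, x i + -δ' * u i = x i + δ' * -u i := fun i => by ring
    simp only [this]; ring
  rw [f1, f2]
  calc _ ≤ a * Real.exp (δ * g) * Real.exp (2 * P - 2 * (x p + δ) ^ 2 * g ^ 2) +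
        a' * Real.exp (-δ' * g) * Real.exp (2 * P - 2 * (x p + δ' * -1) ^ 2 * g ^ 2) := by
        gcongr
    _ = Real.exp (2 * P - x p * g) * (a * Real.exp ((x p + δ) * g - 2 * (x p + δ) ^ 2 * g ^ 2) +
        a' * Real.exp ((x p - δ') * g - 2 * (x p - δ') ^ 2 * g ^ 2)) := by
        rw [mul_add]
        congr 1
        · rw [mul_assoc, ← Real.exp_add, mul_left_comm, ← Real.exp_add]
          ring_nf
        · rw [mul_assoc, ← Real.exp_add, mul_left_comm, ← Real.exp_add]
          ring_nf
    _ ≤ Real.exp (2 * P - x p * g) * Real.exp (x p * g - 2 * x p ^ 2 * g ^ 2) := by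
        gcongr
    _ = _ := by rw [← Real.exp_add]; ring_nf

theorem hasRounding {b : ι → E} (hb : ∀ i, ‖b i‖ ≤ 1) (p : ι) (S : Finset ι) (hp : p ∉ S)
    (x : ι → ℝ) (hx : ∀ i, |x i| ≤ 1) : HasRounding b p S x := by
  induction hm : S.card using Nat.strong_induction_on generalizing p S x with
  | _ m IH =>
  have IH' : ∀ y : ι → ℝ, (∀ i, |y i| ≤ 1) → ∀ q T, q ∉ T → T.card < S.card →
      HasRounding b q T y := fun y hy q T hq hT => IH _ (hm ▸ hT) q T hq y hy rfl
  by_cases hfr : ∃ i ∈ insert p S, |x i| = 1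
  · obtain ⟨i, hi, hi1⟩ := hfr
    exact hasRounding_of_abs_eq_one hb hp hx (IH' x hx) hi hi1
  push Not at hfr
  have hlt : ∀ i ∈ insert p S, |x i| < 1 := fun i hi => lt_of_le_of_ne (hx i) (hfr i hi)
  obtain ⟨v, hv⟩ := (Submodule.mem_span_image_finset_iff_exists_fun' ℝ).1
    ((Submodule.span ℝ (b '' S)).starProjection_apply_mem (b p))
  -- The pivot moves at unit speed while the other live coordinates cancel the component of `b p` in
  -- their span; this is the Gram–Schmidt direction.
  set u : ι → ℝ := fun i => if i = p then 1 else if i ∈ S then -v i else 0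
  have hup : u p = 1 := by simp [u]
  have hu0 : ∀ i ∉ insert p S, u i = 0 := by
    intro i hi
    simp only [Finset.mem_insert, not_or] at hi
    simp [u, hi.1, hi.2]
  have hu : ∑ i, u i • b i = perp (Submodule.span ℝ (b '' S)) (b p) := by
    rw [← Finset.sum_subset (Finset.subset_univ (insert p S))
      (fun i _ hi => by rw [hu0 i hi, zero_smul]), Finset.sum_insert hp, hup, one_smul, perp,
      ← hv, sub_eq_add_neg, ← Finset.sum_neg_distrib]
    congr 1
    refine Finset.sum_congr rfl fun i hi => ?_
    have : i ≠ p := fun h => hp (h ▸ hi)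
    simp [u, this, hi]
  have hstep : ∀ u' : ι → ℝ, |u' p| = 1 → (∀ i ∉ insert p S, u' i = 0) →
      ∃ δ : ℝ, 0 < δ ∧ |x p + δ * u' p| ≤ 1 ∧ HasRounding b p S fun i => x i + δ * u' i := by
    intro u' hu1 hu2
    obtain ⟨δ, hδ, hA, i, hi, hi1⟩ := exists_step_to_boundary (insert p S) x u'
      (Finset.mem_insert_self p S) hu1 hlt
    have hbox : ∀ j, |x j + δ * u' j| ≤ 1 := fun j => by
      by_cases hj : j ∈ insert p S
      · exact hA j hj
      · simpa [hu2 j hj] using hx j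
    exact ⟨δ, hδ, hbox p, hasRounding_of_abs_eq_one hb hp hbox (IH' _ hbox) hi hi1⟩
  obtain ⟨δ, hδ, hd1, hR1⟩ := hstep u (by simp [hup]) hu0
  obtain ⟨δ', hδ', hd2, hR2⟩ := hstep (fun i => -u i) (by simp [hup])
    (fun i hi => by simp [hu0 i hi])
  refine hasRounding_step hb hup hu hu0 hδ hδ' hR1 hR2 ?_ ?_
  · simpa [hup] using hd1
  · simpa [hup, sub_eq_add_neg] using hd2

/-- Sub-Gaussian rounding of fractional signs (the Gram–Schmidt walk). -/
theorem exists_subgaussian_rounding {b : ι → E} (hb : ∀ i, ‖b i‖ ≤ 1) (A : Finset ι)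
    (x : ι → ℝ) (hx : ∀ i, |x i| ≤ 1) :
    ∃ (Ω : Type) (_ : Fintype Ω) (w : Ω → ℝ) (Y : Ω → ι → ℝ),
      (∀ ω, 0 ≤ w ω) ∧ ∑ ω, w ω = 1 ∧ (∀ ω, ∀ i ∈ A, |Y ω i| = 1) ∧
      (∀ ω, ∀ i ∉ A, Y ω i = x i) ∧
      ∀ θ : E, ‖θ‖ ≤ 1 / 4 →
        ∑ ω, w ω * Real.exp (inner ℝ (∑ i, (Y ω i - x i) • b i) θ) ≤
          Real.exp (2 * ‖θ‖ ^ 2) := by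
  rcases A.eq_empty_or_nonempty with rfl | ⟨p, hp⟩
  · refine ⟨Unit, inferInstance, fun _ => 1, fun _ => x, fun _ => zero_le_one, by simp, by simp,
        fun _ _ _ => rfl, fun θ _ => ?_⟩
    simp only [sub_self, zero_smul, Finset.sum_const_zero, inner_zero_left, Real.exp_zero,
      mul_one, Finset.univ_unique, Finset.sum_singleton]
    exact Real.one_le_exp (by positivity)
  obtain ⟨Ω, hΩ, w, Y, hw, hw1, hY, hYx, hE⟩ := hasRounding hb p (A.erase p)
    (Finset.notMem_erase _ _) x hx
  rw [Finset.insert_erase hp] at hY hYx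
  refine ⟨Ω, hΩ, w, Y, hw, hw1, hY, hYx, fun θ hθ => (hE θ hθ).trans (Real.exp_le_exp.2 ?_)⟩
  have h1 : ‖(Submodule.span ℝ (b '' (A.erase p : Finset ι)) ⊔ ℝ ∙ b p).starProjection θ‖ ^ 2 ≤
      ‖θ‖ ^ 2 := by
    have := (Submodule.span ℝ (b '' (A.erase p : Finset ι)) ⊔ ℝ ∙ b p).norm_starProjection_apply_le θ
    gcongr
  have h2 : 0 ≤ 2 * x p ^ 2 *
      inner ℝ (perp (Submodule.span ℝ (b '' (A.erase p : Finset ι))) (b p)) θ ^ 2 := by positivity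
  linarith

end Walk

/-! ### Moment bounds from the exponential-moment bound. -/

section SubGaussian

variable {E : Type*} [NormedAddCommGroup E] [InnerProductSpace ℝ E]
variable {Ω : Type*} [Fintype Ω] {w : Ω → ℝ} {Z : Ω → E}

lemma exp_inv_eight_le : Real.exp (1 / 8) ≤ 5 / 4 := by
  have h : Real.exp (1 / 8) ^ 8 = Real.exp 1 := by
    rw [← Real.exp_nat_mul]; norm_num
  have h2 := Real.exp_one_lt_d9
  by_contra! h3
  have : (5 / 4 : ℝ) ^ 8 < Real.exp (1 / 8) ^ 8 := by gcongr
  norm_num [h] at this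
  linarith

lemma exp_two_mul_sq_le {t : ℝ} (h : t ^ 2 ≤ 1 / 16) : Real.exp (2 * t ^ 2) ≤ 5 / 4 :=
  (Real.exp_le_exp.2 (by linarith)).trans exp_inv_eight_le

lemma sq_le_exp_add_exp_neg_sub_two (y : ℝ) : y ^ 2 ≤ Real.exp y + Real.exp (-y) - 2 := by
  have h1 : Real.exp y + Real.exp (-y) - 2 = (2 * Real.sinh (y / 2)) ^ 2 := by
    rw [Real.sinh_eq]
    have e1 : Real.exp y = Real.exp (y / 2) ^ 2 := by rw [← Real.exp_nat_mul]; ring_nf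
    have e2 : Real.exp (-y) = Real.exp (-(y / 2)) ^ 2 := by rw [← Real.exp_nat_mul]; ring_nf
    have e3 : Real.exp (y / 2) * Real.exp (-(y / 2)) = 1 := by rw [← Real.exp_add]; simp
    rw [e1, e2]
    linear_combination 2 * e3
  rw [h1, ← sq_abs, ← sq_abs (2 * _)]
  have : |y / 2| ≤ |Real.sinh (y / 2)| := by
    rw [Real.abs_sinh]
    exact Real.self_le_sinh_iff.2 (abs_nonneg _)
  rw [abs_div, abs_two] at this
  rw [abs_mul, abs_two]
  gcongr
  linarith

lemma sum_exp_abs_inner_le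
    (h : ∀ θ : E, ‖θ‖ ≤ 1 / 4 → ∑ ω, w ω * Real.exp (inner ℝ (Z ω) θ) ≤ Real.exp (2 * ‖θ‖ ^ 2))
    (hw : ∀ ω, 0 ≤ w ω) {θ : E} (hθ : ‖θ‖ ^ 2 ≤ 1 / 16) :
    ∑ ω, w ω * Real.exp |inner ℝ (Z ω) θ| ≤ 5 / 2 := by
  have hθ' : ‖θ‖ ≤ 1 / 4 := (abs_le_of_sq_le_sq' (by linarith) (by norm_num)).2
  have h1 := h θ hθ'
  have h2 := h (-θ) (by simpa using hθ')
  rw [norm_neg] at h2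
  simp only [inner_neg_right] at h2
  have h3 := exp_two_mul_sq_le hθ
  calc _ ≤ ∑ ω, (w ω * Real.exp (inner ℝ (Z ω) θ) + w ω * Real.exp (-inner ℝ (Z ω) θ)) := by
        refine Finset.sum_le_sum fun ω _ => ?_
        rw [← mul_add]
        refine mul_le_mul_of_nonneg_left ?_ (hw ω)
        rcases abs_choice (inner ℝ (Z ω) θ) with h | h <;> rw [h]
        · linarith [Real.exp_pos (-inner ℝ (Z ω) θ)]
        · linarith [Real.exp_pos (inner ℝ (Z ω) θ)]
    _ ≤ _ := by rw [Finset.sum_add_distrib]; linarith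

/-- Scale `θ` to norm `1/4` and use `y² ≤ exp y + exp (-y) - 2`; the constant 8 comes from `2 *
(5/4) - 2 = 8 / 16`. -/
lemma sum_sq_inner_le
    (h : ∀ θ : E, ‖θ‖ ≤ 1 / 4 → ∑ ω, w ω * Real.exp (inner ℝ (Z ω) θ) ≤ Real.exp (2 * ‖θ‖ ^ 2))
    (hw : ∀ ω, 0 ≤ w ω) (hw1 : ∑ ω, w ω = 1) (θ : E) :
    ∑ ω, w ω * inner ℝ (Z ω) θ ^ 2 ≤ 8 * ‖θ‖ ^ 2 := by
  rcases eq_or_ne θ 0 with rfl | hθ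
  · simp
  have hpos : 0 < ‖θ‖ := norm_pos_iff.2 hθ
  set t : ℝ := 1 / (4 * ‖θ‖)
  have hn : ‖t • θ‖ = 1 / 4 := by
    rw [norm_smul, Real.norm_of_nonneg (by positivity)]
    simp only [t]; field_simp
  have h1 := h (t • θ) hn.le
  have h2 := h (-(t • θ)) (by rw [norm_neg]; exact hn.le)
  rw [norm_neg] at h2
  have h3 : Real.exp (2 * ‖t • θ‖ ^ 2) ≤ 5 / 4 := exp_two_mul_sq_le (by rw [hn]; norm_num)
  simp only [inner_neg_right, inner_smul_right] at h1 h2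
  have h4 : ∑ ω, w ω * (t * inner ℝ (Z ω) θ) ^ 2 ≤ ∑ ω, (w ω * Real.exp (t * inner ℝ (Z ω) θ) +
      w ω * Real.exp (-(t * inner ℝ (Z ω) θ)) - 2 * w ω) := by
    refine Finset.sum_le_sum fun ω _ => ?_
    have := mul_le_mul_of_nonneg_left
      (sq_le_exp_add_exp_neg_sub_two (t * inner ℝ (Z ω) θ)) (hw ω)
    linarith
  rw [Finset.sum_sub_distrib, Finset.sum_add_distrib, ← Finset.mul_sum, hw1] at h4
  have h5 : ∑ ω, w ω * (t * inner ℝ (Z ω) θ) ^ 2 = t ^ 2 * ∑ ω, w ω * inner ℝ (Z ω) θ ^ 2 := by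
    rw [Finset.mul_sum]
    exact Finset.sum_congr rfl fun ω _ => by ring
  rw [h5] at h4
  have h6 : t ^ 2 * ∑ ω, w ω * inner ℝ (Z ω) θ ^ 2 ≤ t ^ 2 * (8 * ‖θ‖ ^ 2) := by
    have : t ^ 2 * (8 * ‖θ‖ ^ 2) = 1 / 2 := by simp only [t]; field_simp; norm_num
    rw [this]; linarith
  exact le_of_mul_le_mul_left h6 (by positivity)

lemma sum_norm_sq_le (K : Submodule ℝ E) [FiniteDimensional ℝ K] {C : ℝ}
    (h : ∀ θ : E, ∑ ω, w ω * inner ℝ (Z ω) θ ^ 2 ≤ C * ‖θ‖ ^ 2) (hZ : ∀ ω, Z ω ∈ K) :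
    ∑ ω, w ω * ‖Z ω‖ ^ 2 ≤ C * Module.finrank ℝ K := by
  set e := stdOrthonormalBasis ℝ K
  have hs : ∀ ω, ‖Z ω‖ ^ 2 = ∑ j, inner ℝ (Z ω) (e j : E) ^ 2 := by
    intro ω
    have := e.sum_sq_norm_inner_left ⟨Z ω, hZ ω⟩
    simp only [Real.norm_eq_abs, sq_abs, Submodule.coe_inner] at this
    exact this.symm
  simp only [hs, Finset.mul_sum]
  rw [Finset.sum_comm]
  calc _ ≤ ∑ j, C * ‖(e j : E)‖ ^ 2 := Finset.sum_le_sum fun j _ => h _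
    _ = _ := by
      have : ∀ j, ‖(e j : E)‖ = 1 := fun j => e.orthonormal.1 j
      simp [this, mul_comm]

end SubGaussian

/-! ### The random perturbations adapted to given vectors `r`. -/

theorem exists_hard_family {F : Type*} [NormedAddCommGroup F] [InnerProductSpace ℝ F]
    [FiniteDimensional ℝ F] {k : ℕ} {a : ℝ} (ha : 0 < a) (ha1 : a ≤ 1 / 10)
    (hk : 16 ≤ a ^ 4 * k) (r : Fin k → F) (hr : ∑ x, ‖r x‖ ^ 2 ≤ a * k / 2) :
    ∃ (Ω : Type) (_ : Fintype Ω) (w : Ω → ℝ) (f : Ω → Fin k → ℝ),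
      (∀ ω, 0 ≤ w ω) ∧ ∑ ω, w ω = 1 ∧ (∀ ω x, -1 ≤ f ω x) ∧
      (∀ ω, w ω ≠ 0 → |∑ x, f ω x| ≤ a * k) ∧
      (∀ ω, w ω ≠ 0 → (1 - 2 * a) * k ≤ (Finset.univ.filter fun x => f ω x = -1).card) ∧
      ∀ M : ℝ, 40 * k * M ^ 2 ≤ a ^ 4 →
        ∑ ω, ∑ ω', w ω * w ω' *
          Real.exp |M * inner ℝ (∑ x, f ω x • r x) (∑ x, f ω' x • r x)| ≤ 5 := by
  classical
  have hk0 : (0 : ℝ) < k := by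
    by_contra! h
    nlinarith [mul_nonneg (pow_pos ha 4).le (neg_nonneg.2 h)]
  set A : Finset (Fin k) := Finset.univ.filter fun x => ‖r x‖ ^ 2 ≤ 1 / 2
  set c : ℝ := √(1 / 2)
  have hc : c ^ 2 = 1 / 2 := Real.sq_sqrt (by norm_num)
  -- Each short `r x` is augmented by a multiple of a basis vector, still with norm at most 1: the
  -- first block controls the sum of the perturbation, the second controls `R`.
  set b : Fin k → WithLp 2 (EuclideanSpace ℝ (Fin k) × F) := fun x =>
    if x ∈ A then WithLp.toLp 2 (EuclideanSpace.single x c, r x) else 0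
  have hb : ∀ x, ‖b x‖ ≤ 1 := by
    intro x
    by_cases hx : x ∈ A
    · have h1 : ‖r x‖ ^ 2 ≤ 1 / 2 := (Finset.mem_filter.1 hx).2
      have h2 : ‖b x‖ ^ 2 ≤ 1 := by
        simp only [b, hx, if_true]
        rw [WithLp.prod_norm_sq_eq_of_L2]
        change ‖EuclideanSpace.single x c‖ ^ 2 + ‖r x‖ ^ 2 ≤ 1
        rw [PiLp.norm_single, Real.norm_eq_abs, sq_abs, hc]
        linarith
      exact (abs_le_of_sq_le_sq' (by linarith) zero_le_one).2
    · simp [b, hx]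
  -- Mean `2a - 1` means sign `+1` with probability `a`. After centring and division by `2a`, the
  -- values on `A` are `-1` and `(1 - a) / a`, and the value off `A` is 0.
  obtain ⟨Ω, hΩ, w, X, hw, hw1, hXA, hXx, hE⟩ := exists_subgaussian_rounding hb A
    (fun _ => 2 * a - 1) (fun _ => abs_le.2 ⟨by linarith, by linarith⟩)
  set d : Ω → Fin k → ℝ := fun ω x => X ω x - (2 * a - 1)
  have hd0 : ∀ ω, ∀ x ∉ A, d ω x = 0 := fun ω x hx => by simp [d, hXx ω x hx]
  have hdA : ∀ ω, ∀ x ∈ A, d ω x = -(2 * a) ∨ d ω x = 2 - 2 * a := by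
    intro ω x hx
    rcases (abs_eq zero_le_one).1 (hXA ω x hx) with h | h
    · right; simp only [d, h]; ring
    · left; simp only [d, h]; ring
  set Z : Ω → WithLp 2 (EuclideanSpace ℝ (Fin k) × F) := fun ω => ∑ x, d ω x • b x
  set R : Ω → F := fun ω => ∑ x, d ω x • r x
  have hbfst : ∀ ω x, d ω x • (b x).fst = d ω x • EuclideanSpace.single x c := by
    intro ω x
    by_cases hx : x ∈ A
    · simp [b, hx]
    · simp [hd0 ω x hx]
  have hbsnd : ∀ ω x, d ω x • (b x).snd = d ω x • r x := by
    intro ω x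
    by_cases hx : x ∈ A
    · simp [b, hx]
    · simp [hd0 ω x hx]
  have hZ1 : ∀ ω, (Z ω).fst = ∑ x, d ω x • EuclideanSpace.single x c := by
    intro ω
    simp only [← hbfst, Z, ← WithLp.fstL_apply (p := 2) (𝕜 := ℝ), map_sum, map_smul]
  have hZ2 : ∀ ω, (Z ω).snd = R ω := by
    intro ω
    simp only [R, ← hbsnd, Z, ← WithLp.sndL_apply (p := 2) (𝕜 := ℝ), map_sum, map_smul]
  have hsq := sum_sq_inner_le hE hw hw1
  have hD : ∑ ω, w ω * (∑ x, d ω x) ^ 2 ≤ 16 * k := by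
    have h := hsq (WithLp.toLp 2 (WithLp.toLp 2 fun _ => 1, 0))
    have hin : ∀ ω, inner ℝ (Z ω) (WithLp.toLp 2 (WithLp.toLp 2 fun _ => 1, 0)) =
        c * ∑ x, d ω x := by
      intro ω
      rw [WithLp.prod_inner_apply]
      change inner ℝ (Z ω).fst _ + inner ℝ (Z ω).snd 0 = _
      rw [hZ1, inner_zero_right, add_zero, sum_inner, Finset.mul_sum]
      refine Finset.sum_congr rfl fun x _ => ?_
      rw [inner_smul_left, EuclideanSpace.inner_single_left]
      simp [mul_comm]
    have hno : ‖(WithLp.toLp 2 (WithLp.toLp 2 fun _ => 1, 0) :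
        WithLp 2 (EuclideanSpace ℝ (Fin k) × F))‖ ^ 2 = k := by
      rw [WithLp.prod_norm_sq_eq_of_L2]
      simp [EuclideanSpace.norm_sq_eq]
    change ∑ ω, w ω * inner ℝ (Z ω) _ ^ 2 ≤ _ at h
    simp only [hin, hno, mul_pow, hc] at h
    have h2 : ∑ ω, w ω * (1 / 2 * (∑ x, d ω x) ^ 2) = 1 / 2 * ∑ ω, w ω * (∑ x, d ω x) ^ 2 := by
      rw [Finset.mul_sum]; exact Finset.sum_congr rfl fun ω _ => by ring
    rw [h2] at h
    linarith
  have hR : ∑ ω, w ω * ‖R ω‖ ^ 2 ≤ 8 * k := by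
    have h := sum_norm_sq_le (Submodule.span ℝ (Set.range b)) hsq (fun ω =>
      Submodule.sum_mem _ fun x _ => Submodule.smul_mem _ _ (Submodule.subset_span ⟨x, rfl⟩))
    have hf : (Module.finrank ℝ (Submodule.span ℝ (Set.range b)) : ℝ) ≤ k := by
      have := finrank_range_le_card (R := ℝ) b
      rw [Fintype.card_fin] at this
      exact_mod_cast this
    calc _ ≤ ∑ ω, w ω * ‖Z ω‖ ^ 2 := by
          refine Finset.sum_le_sum fun ω _ => mul_le_mul_of_nonneg_left ?_ (hw ω)
          rw [WithLp.prod_norm_sq_eq_of_L2, hZ2]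
          nlinarith [sq_nonneg ‖(Z ω).fst‖]
      _ ≤ _ := h
      _ ≤ _ := by gcongr
  -- By Markov, using `16 ≤ a ^ 4 * k`, each condition fails with probability at most `1/4`.
  -- Conditioning on `G` then costs a factor of at most 2 in expectations, whence `5 = 2 * (5/2)` at
  -- the end.
  set G : Finset Ω := Finset.univ.filter fun ω =>
    (∑ x, d ω x) ^ 2 ≤ 4 * a ^ 4 * k ^ 2 ∧ ‖R ω‖ ^ 2 ≤ 40 * k
  set P := ∑ ω ∈ G, w ω
  have hP : 1 / 2 ≤ P := by
    have h1 : ∀ ω, w ω ≤ (if ω ∈ G then w ω else 0) +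
        (w ω * (∑ x, d ω x) ^ 2 / (4 * a ^ 4 * k ^ 2) + w ω * ‖R ω‖ ^ 2 / (40 * k)) := by
      intro ω
      have p1 : 0 ≤ w ω * (∑ x, d ω x) ^ 2 / (4 * a ^ 4 * k ^ 2) := by
        have := hw ω
        positivity
      have p2 : 0 ≤ w ω * ‖R ω‖ ^ 2 / (40 * k) := by
        have := hw ω
        positivity
      by_cases hG : ω ∈ G
      · rw [if_pos hG]; linarith
      rw [if_neg hG]
      simp only [G, Finset.mem_filter, Finset.mem_univ, true_and, not_and_or, not_le] at hG
      rcases hG with hG | hG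
      · have : w ω ≤ w ω * (∑ x, d ω x) ^ 2 / (4 * a ^ 4 * k ^ 2) := by
          rw [le_div_iff₀ (by positivity)]
          exact mul_le_mul_of_nonneg_left hG.le (hw ω)
        linarith
      · have : w ω ≤ w ω * ‖R ω‖ ^ 2 / (40 * k) := by
          rw [le_div_iff₀ (by positivity)]
          exact mul_le_mul_of_nonneg_left hG.le (hw ω)
        linarith
    have h2 := Finset.sum_le_sum fun ω (_ : ω ∈ Finset.univ) => h1 ω
    rw [hw1, Finset.sum_add_distrib, Finset.sum_add_distrib, ← Finset.sum_div, ← Finset.sum_div,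
      Finset.sum_ite_mem, Finset.univ_inter] at h2
    have h3 : (∑ ω, w ω * (∑ x, d ω x) ^ 2) / (4 * a ^ 4 * k ^ 2) ≤ 1 / 4 := by
      rw [div_le_iff₀ (by positivity)]
      nlinarith
    have h4 : (∑ ω, w ω * ‖R ω‖ ^ 2) / (40 * k) ≤ 1 / 4 := by
      rw [div_le_iff₀ (by positivity)]
      nlinarith
    linarith
  have hP0 : 0 < P := by linarith
  have hsup : ∀ ω, (if ω ∈ G then w ω / P else 0) ≠ 0 → ω ∈ G := by
    intro ω h
    by_contra h'
    simp [h'] at h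
  have hnn : ∀ ω, 0 ≤ if ω ∈ G then w ω / P else 0 := by
    intro ω
    split_ifs
    · exact div_nonneg (hw ω) hP0.le
    · exact le_rfl
  have hsum1 : (∑ ω, if ω ∈ G then w ω / P else 0) = 1 := by
    rw [Finset.sum_ite_mem, Finset.univ_inter, ← Finset.sum_div]
    exact div_self hP0.ne'
  have hsumf : ∀ ω, ω ∈ G → |∑ x, d ω x / (2 * a)| ≤ a * k := by
    intro ω hω
    rw [← Finset.sum_div, abs_div, abs_of_pos (by positivity : 0 < 2 * a),
      div_le_iff₀ (by positivity)]
    refine abs_le_of_sq_le_sq ((Finset.mem_filter.1 hω).2.1.trans (le_of_eq (by ring)))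
      (by positivity)
  refine ⟨Ω, hΩ, fun ω => if ω ∈ G then w ω / P else 0, fun ω x => d ω x / (2 * a),
    hnn, hsum1, fun ω x => ?_, fun ω hω => hsumf ω (hsup ω hω), fun ω hω => ?_, fun M hM => ?_⟩
  · rw [le_div_iff₀ (by positivity)]
    by_cases hx : x ∈ A
    · rcases hdA ω x hx with h | h <;> rw [h] <;> linarith
    · rw [hd0 ω x hx]; linarith
  · have hA : (1 - a) * k ≤ A.card := by
      have h1 : ∀ x, (1 : ℝ) ≤ (if x ∈ A then 1 else 0) + 2 * ‖r x‖ ^ 2 := by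
        intro x
        by_cases hx : x ∈ A
        · rw [if_pos hx]; nlinarith [sq_nonneg ‖r x‖]
        · rw [if_neg hx]
          simp only [A, Finset.mem_filter, Finset.mem_univ, true_and, not_le] at hx
          linarith
      have h2 := Finset.sum_le_sum fun x (_ : x ∈ Finset.univ) => h1 x
      rw [Finset.sum_add_distrib, Finset.sum_ite_mem, Finset.univ_inter, ← Finset.mul_sum] at h2
      simp only [Finset.sum_const, Finset.card_univ, Fintype.card_fin, nsmul_eq_mul, mul_one] at h2
      linarith
    -- The left side is 1 at value `-1` and 0 at value `(1 - a) / a`. Summing, with `|A| ≥ (1 - a)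
    -- k` and the sum of the perturbation at most `a k`, gives `(1 - a)² - a² = 1 - 2a`.
    have h1 : ∀ x, (1 - a) * (if x ∈ A then 1 else 0) - a * (d ω x / (2 * a)) ≤
        if d ω x / (2 * a) = -1 then (1 : ℝ) else 0 := by
      intro x
      by_cases hx : x ∈ A
      · rcases hdA ω x hx with h | h
        · have : d ω x / (2 * a) = -1 := by rw [h]; field_simp
          rw [this, if_pos hx, if_pos rfl]; linarith
        · have h3 : a * (d ω x / (2 * a)) = 1 - a := by rw [h]; field_simp
          rw [if_pos hx, h3]
          split_ifs <;> linarith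
      · simp [hx, hd0 ω x hx]
    have h2 := Finset.sum_le_sum fun x (_ : x ∈ Finset.univ) => h1 x
    rw [Finset.sum_sub_distrib, ← Finset.mul_sum, ← Finset.mul_sum, Finset.sum_ite_mem,
      Finset.univ_inter, Finset.sum_boole] at h2
    simp only [Finset.sum_const, nsmul_eq_mul, mul_one] at h2
    have h3 := (abs_le.1 (hsumf ω (hsup ω hω))).2
    nlinarith
  · have hRf : ∀ ω, ∑ x, (d ω x / (2 * a)) • r x = (1 / (2 * a)) • R ω := by
      intro ω
      simp only [R, Finset.smul_sum, smul_smul]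
      exact Finset.sum_congr rfl fun x _ => by ring_nf
    have hone : ∀ ω', (if ω' ∈ G then w ω' / P else 0) ≠ 0 →
        ∑ ω, (if ω ∈ G then w ω / P else 0) * Real.exp |M * inner ℝ (∑ x, (d ω x / (2 * a)) • r x)
          (∑ x, (d ω' x / (2 * a)) • r x)| ≤ 5 := by
      intro ω' hω'
      have hR' := (Finset.mem_filter.1 (hsup ω' hω')).2.2
      -- With `ω'` fixed, the inner product is a linear functional of `Z ω`; the bound on `‖R ω'‖`
      -- in `G` and the condition on `M` keep `‖θ‖ ≤ 1/4`.
      set θ : WithLp 2 (EuclideanSpace ℝ (Fin k) × F) :=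
        WithLp.toLp 2 (0, (M / (4 * a ^ 2)) • R ω')
      have hθ : ‖θ‖ ^ 2 ≤ 1 / 16 := by
        rw [WithLp.prod_norm_sq_eq_of_L2]
        change ‖(0 : EuclideanSpace ℝ (Fin k))‖ ^ 2 + ‖(M / (4 * a ^ 2)) • R ω'‖ ^ 2 ≤ _
        rw [norm_zero, norm_smul, mul_pow, Real.norm_eq_abs, sq_abs, div_pow]
        calc (0 : ℝ) ^ 2 + M ^ 2 / (4 * a ^ 2) ^ 2 * ‖R ω'‖ ^ 2
            ≤ 0 ^ 2 + M ^ 2 / (4 * a ^ 2) ^ 2 * (40 * k) := by gcongr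
          _ = (40 * k * M ^ 2) / (16 * a ^ 4) := by ring
          _ ≤ a ^ 4 / (16 * a ^ 4) := by gcongr
          _ = 1 / 16 := by field_simp
      have hin : ∀ ω, M * inner ℝ (∑ x, (d ω x / (2 * a)) • r x) (∑ x, (d ω' x / (2 * a)) • r x) =
          inner ℝ (Z ω) θ := by
        intro ω
        rw [WithLp.prod_inner_apply]
        change _ = inner ℝ (Z ω).fst 0 + inner ℝ (Z ω).snd ((M / (4 * a ^ 2)) • R ω')
        rw [inner_zero_right, zero_add, hZ2, hRf, hRf, inner_smul_left, inner_smul_right,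
          inner_smul_right]
        simp only [conj_trivial]
        field_simp
        ring
      simp only [hin]
      have key := sum_exp_abs_inner_le hE hw hθ
      calc _ ≤ ∑ ω, 2 * (w ω * Real.exp |inner ℝ (Z ω) θ|) := by
            refine Finset.sum_le_sum fun ω _ => ?_
            rw [← mul_assoc]
            refine mul_le_mul_of_nonneg_right ?_ (Real.exp_pos _).le
            split_ifs
            · rw [div_le_iff₀ hP0]; nlinarith [hw ω]
            · nlinarith [hw ω]
        _ ≤ 5 := by
            rw [← Finset.mul_sum]
            change ∑ ω, w ω * Real.exp |inner ℝ (Z ω) θ| ≤ _ at key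
            linarith
    rw [Finset.sum_comm]
    calc _ = ∑ ω', (if ω' ∈ G then w ω' / P else 0) * ∑ ω, (if ω ∈ G then w ω / P else 0) *
          Real.exp |M * inner ℝ (∑ x, (d ω x / (2 * a)) • r x)
          (∑ x, (d ω' x / (2 * a)) • r x)| := by
          refine Finset.sum_congr rfl fun ω' _ => ?_
          rw [Finset.mul_sum]
          exact Finset.sum_congr rfl fun ω _ => by ring
      _ ≤ ∑ ω', (if ω' ∈ G then w ω' / P else 0) * 5 := by
          refine Finset.sum_le_sum fun ω' _ => ?_
          by_cases h : (if ω' ∈ G then w ω' / P else 0) = 0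
          · rw [h]; simp
          · exact mul_le_mul_of_nonneg_left (hone ω' h) (hnn ω')
      _ = 5 := by rw [← Finset.sum_mul, hsum1, one_mul]

/-! ### The second-moment method for mixtures. -/

section ChiSquare

/-- Cauchy–Schwarz with weight `Q`; the χ²-divergence of the mixture expands into pairwise terms.
`hQR` makes the convention `x / 0 = 0` harmless. -/
lemma sq_sub_le_chiSq_mixture {α Ω : Type*} [Fintype α] [Fintype Ω] {Q : α → ℝ} {R : Ω → α → ℝ}
    {w : Ω → ℝ} {T : α → ℝ} (hQ : ∀ y, 0 ≤ Q y) (hQ1 : ∑ y, Q y = 1)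
    (hR1 : ∀ ω, ∑ y, R ω y = 1) (hQR : ∀ ω y, Q y = 0 → R ω y = 0) (hw1 : ∑ ω, w ω = 1)
    (hT0 : ∀ y, 0 ≤ T y) (hT1 : ∀ y, T y ≤ 1) :
    (∑ y, Q y * T y - ∑ ω, w ω * ∑ y, R ω y * T y) ^ 2 ≤
      ∑ ω, ∑ ω', w ω * w ω' * ∑ y, R ω y * R ω' y / Q y - 1 := by
  set B : α → ℝ := fun y => ∑ ω, w ω * R ω y
  have hB0 : ∀ y, Q y = 0 → B y = 0 := fun y hy =>
    Finset.sum_eq_zero fun ω _ => by rw [hQR ω y hy, mul_zero]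
  have hB1 : ∑ y, B y = 1 := by
    simp only [B]
    rw [Finset.sum_comm]
    simp only [← Finset.mul_sum, hR1, mul_one, hw1]
  have h1 : ∑ y, Q y * T y - ∑ ω, w ω * ∑ y, R ω y * T y = ∑ y, T y * (Q y - B y) := by
    have : ∑ ω, w ω * ∑ y, R ω y * T y = ∑ y, T y * B y := by
      simp only [B, Finset.mul_sum]
      rw [Finset.sum_comm]
      exact Finset.sum_congr rfl fun y _ => Finset.sum_congr rfl fun ω _ => by ring
    rw [this, ← Finset.sum_sub_distrib]
    exact Finset.sum_congr rfl fun y _ => by ring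
  have h2 : ∑ ω, ∑ ω', w ω * w ω' * ∑ y, R ω y * R ω' y / Q y = ∑ y, B y ^ 2 / Q y := by
    have : ∀ y, B y ^ 2 / Q y = ∑ ω, ∑ ω', w ω * w ω' * (R ω y * R ω' y / Q y) := by
      intro y
      rw [sq]
      simp only [B]
      rw [Finset.sum_mul_sum, Finset.sum_div]
      refine Finset.sum_congr rfl fun ω _ => ?_
      rw [Finset.sum_div]
      exact Finset.sum_congr rfl fun ω' _ => by ring
    simp only [this, Finset.mul_sum]
    rw [Finset.sum_comm' (t' := Finset.univ) (s' := fun _ => Finset.univ) (by simp)]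
    conv_rhs => rw [Finset.sum_comm]
    rw [Finset.sum_comm]
    refine Finset.sum_congr rfl fun ω _ => ?_
    rw [Finset.sum_comm]
  have h3 : ∑ y, (Q y - B y) ^ 2 / Q y = ∑ y, B y ^ 2 / Q y - 1 := by
    have : ∀ y, (Q y - B y) ^ 2 / Q y = Q y - 2 * B y + B y ^ 2 / Q y := by
      intro y
      by_cases hy : Q y = 0
      · simp [hy, hB0 y hy]
      · field_simp; ring
    simp only [this, Finset.sum_add_distrib, Finset.sum_sub_distrib, ← Finset.mul_sum, hQ1, hB1]
    ring
  rw [h1, h2, ← h3]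
  calc _ ≤ (∑ y, T y ^ 2 * Q y) * ∑ y, (Q y - B y) ^ 2 / Q y := by
        refine Finset.sum_sq_le_sum_mul_sum_of_sq_le_mul _ (fun y _ => ?_) (fun y _ => ?_)
          fun y _ => ?_
        · exact mul_nonneg (sq_nonneg _) (hQ y)
        · exact div_nonneg (sq_nonneg _) (hQ y)
        · by_cases hy : Q y = 0
          · simp [hy, hB0 y hy]
          · exact le_of_eq (by field_simp)
    _ ≤ 1 * ∑ y, (Q y - B y) ^ 2 / Q y := by
        refine mul_le_mul_of_nonneg_right ?_
          (Finset.sum_nonneg fun y _ => div_nonneg (sq_nonneg _) (hQ y))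
        rw [← hQ1]
        refine Finset.sum_le_sum fun y _ => mul_le_of_le_one_left (hQ y) ?_
        exact pow_le_one₀ (hT0 y) (hT1 y)
    _ = _ := one_mul _

end ChiSquare

/-! ### Reduction to averaged channels and product message laws. -/

section Protocol

variable {k n : ℕ} {Y : Type} [Fintype Y]

lemma Channel.output_nonneg (W : Channel k Y) (p : Dist k) (y : Y) : 0 ≤ W.output p y :=
  Finset.sum_nonneg fun x _ => mul_nonneg (p.2.1 x) ((W x).2.1 y)

lemma Channel.sum_output (W : Channel k Y) (p : Dist k) : ∑ y, W.output p y = 1 := by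
  simp only [Channel.output]
  rw [Finset.sum_comm]
  simp only [← Finset.mul_sum]
  have : ∀ x, ∑ y, W x y = 1 := fun x => (W x).2.2
  simp only [this, mul_one]
  exact p.2.2

variable {𝒲 : Set (Channel k Y)}

namespace PrivateCoinProtocol

lemma measurable_channel_apply (P : PrivateCoinProtocol.{u} 𝒲 n) (i : Fin n) (x : Fin k) (y : Y) :
    Measurable fun c => P.channel i c x y := by
  have h1 : Measurable fun c => P.channel i c x := (measurable_pi_apply x).comp (P.measurable_channel i)
  exact (measurable_pi_apply y).comp (measurable_subtype_coe.comp h1)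

lemma integrable_channel_apply (P : PrivateCoinProtocol.{u} 𝒲 n) (i : Fin n) (x : Fin k) (y : Y) :
    Integrable (fun c => P.channel i c x y) (P.law i) := by
  refine Integrable.of_bound (P.measurable_channel_apply i x y).aestronglyMeasurable 1
    (Filter.Eventually.of_forall fun c => ?_)
  have h0 : 0 ≤ P.channel i c x y := (P.channel i c x).2.1 y
  have h1 : ∑ y, P.channel i c x y = 1 := (P.channel i c x).2.2
  rw [Real.norm_of_nonneg h0, ← h1]
  exact Finset.single_le_sum (f := fun y => P.channel i c x y)
    (fun z _ => (P.channel i c x).2.1 z) (Finset.mem_univ y)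

/-- The channel of player `i` averaged over its private coin. -/
noncomputable def avgChannel (P : PrivateCoinProtocol.{u} 𝒲 n) (i : Fin n) : Channel k Y :=
  fun x => ⟨fun y => ∫ c, P.channel i c x y ∂P.law i,
    fun y => integral_nonneg fun c => (P.channel i c x).2.1 y, by
      rw [← integral_finsetSum _ fun y _ => P.integrable_channel_apply i x y]
      have : ∀ c, ∑ y, P.channel i c x y = 1 := fun c => (P.channel i c x).2.2
      simp [this]⟩

/-- Only here is the independence of the coins used: it turns the integral over all coins into a
product, which shared randomness would not allow. -/
lemma messageProb_eq_prod (P : PrivateCoinProtocol.{u} 𝒲 n) (p : Dist k) (y : Fin n → Y) :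
    P.messageProb p y = ∏ i, (P.avgChannel i).output p (y i) := by
  rw [messageProb, integral_fintype_prod_eq_prod (f := fun i c => (P.channel i c).output p (y i))]
  refine Finset.prod_congr rfl fun i _ => ?_
  simp only [Channel.output]
  rw [integral_finsetSum _ fun x _ => (P.integrable_channel_apply i x (y i)).const_mul _]
  refine Finset.sum_congr rfl fun x _ => ?_
  rw [integral_const_mul]
  rfl

lemma sum_messageProb (P : PrivateCoinProtocol.{u} 𝒲 n) (p : Dist k) :
    ∑ y, P.messageProb p y = 1 := by
  classical
  simp only [messageProb_eq_prod]
  rw [← Fintype.piFinset_univ, ← Finset.prod_univ_sum]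
  simp [Channel.sum_output]

/-- A test forces every mixture of far distributions to have large `χ²`-divergence from the
reference. -/
theorem IsIdentityTest.lt_chiSq_mixture {P : PrivateCoinProtocol.{u} 𝒲 n}
    {T : (Fin n → Y) → Set.Icc (0 : ℝ) 1} {q : Dist k} {ε : ℝ} (h : P.IsIdentityTest T q ε)
    {Ω : Type*} [Fintype Ω] {w : Ω → ℝ} {p : Ω → Dist k} (hw : ∀ ω, 0 ≤ w ω)
    (hw1 : ∑ ω, w ω = 1) (hp : ∀ ω, w ω ≠ 0 → ε < tvDist (p ω) q)
    (hac : ∀ i y ω, (P.avgChannel i).output q y = 0 → (P.avgChannel i).output (p ω) y = 0) :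
    25 / 36 < ∑ ω, ∑ ω', w ω * w ω' * ∏ i, ∑ y, (P.avgChannel i).output (p ω) y *
      (P.avgChannel i).output (p ω') y / (P.avgChannel i).output q y - 1 := by
  classical
  have hprod : ∀ ω ω', ∏ i, ∑ y, (P.avgChannel i).output (p ω) y *
      (P.avgChannel i).output (p ω') y / (P.avgChannel i).output q y =
      ∑ y, P.messageProb (p ω) y * P.messageProb (p ω') y / P.messageProb q y := by
    intro ω ω'
    rw [Finset.prod_univ_sum, Fintype.piFinset_univ]
    refine Finset.sum_congr rfl fun y _ => ?_
    simp only [messageProb_eq_prod, Finset.prod_div_distrib, Finset.prod_mul_distrib]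
  simp only [hprod]
  have key := sq_sub_le_chiSq_mixture (Q := P.messageProb q) (R := fun ω => P.messageProb (p ω))
    (w := w) (T := fun y => (T y : ℝ))
    (fun y => by
      rw [messageProb_eq_prod]
      exact Finset.prod_nonneg fun i _ => Channel.output_nonneg _ _ _)
    (P.sum_messageProb q) (fun ω => P.sum_messageProb _)
    (fun ω y hy => by
      rw [messageProb_eq_prod, Finset.prod_eq_zero_iff] at hy ⊢
      obtain ⟨i, hi, hi0⟩ := hy
      exact ⟨i, hi, hac i _ ω hi0⟩) hw1 (fun y => (T y).2.1) (fun y => (T y).2.2)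
  refine lt_of_lt_of_le ?_ key
  have h1 : 11 / 12 < ∑ y, P.messageProb q y * (T y : ℝ) := h.1
  have h2 : ∑ ω, w ω * ∑ y, P.messageProb (p ω) y * (T y : ℝ) ≤ 1 / 12 := by
    calc _ ≤ ∑ ω, w ω * (1 / 12) := by
          refine Finset.sum_le_sum fun ω _ => ?_
          by_cases h0 : w ω = 0
          · simp [h0]
          refine mul_le_mul_of_nonneg_left ?_ (hw ω)
          have := h.2 (p ω) (hp ω h0)
          simp only [probZero, mul_sub, mul_one, Finset.sum_sub_distrib, sum_messageProb] at this
          linarith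
      _ = _ := by rw [← Finset.sum_mul, hw1, one_mul]
  -- The acceptance probabilities differ by more than `11/12 - 1/12`, whose square is `25/36`.
  nlinarith

end PrivateCoinProtocol

lemma Channel.output_uniform [NeZero k] (W : Channel k Y) (y : Y) :
    W.output (uniform k) y = (∑ x, W x y) / k := by
  rw [Channel.output, Finset.sum_div]
  refine Finset.sum_congr rfl fun x _ => ?_
  change 1 / (k : ℝ) * _ = _
  ring

lemma Channel.apply_eq_zero_of_sum {W : Channel k Y} {y : Y} (h : ∑ x, W x y = 0) (x : Fin k) :
    W x y = 0 :=
  (Finset.sum_eq_zero_iff_of_nonneg fun x _ => (W x).2.1 y).1 h x (Finset.mem_univ x)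

lemma Channel.output_eq_zero_of_uniform [NeZero k] {W : Channel k Y} {y : Y}
    (h : W.output (uniform k) y = 0) (p : Dist k) : W.output p y = 0 := by
  rw [Channel.output_uniform, div_eq_zero_iff, or_iff_left (Nat.cast_ne_zero.2 (NeZero.ne k))] at h
  exact Finset.sum_eq_zero fun x _ => by rw [Channel.apply_eq_zero_of_sum h x, mul_zero]

lemma Channel.sum_output_mul_output_div [NeZero k] (W : Channel k Y) (p p' : Dist k) :
    ∑ y, W.output p y * W.output p' y / W.output (uniform k) y =
      1 + ∑ y, (W.output p y - W.output (uniform k) y) * (W.output p' y - W.output (uniform k) y) /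
        W.output (uniform k) y := by
  have h : ∀ y, W.output p y * W.output p' y / W.output (uniform k) y = W.output p y +
      W.output p' y - W.output (uniform k) y + (W.output p y - W.output (uniform k) y) *
      (W.output p' y - W.output (uniform k) y) / W.output (uniform k) y := by
    intro y
    by_cases hy : W.output (uniform k) y = 0
    · simp [hy, Channel.output_eq_zero_of_uniform hy]
    · field_simp; ring
  simp only [h, Finset.sum_add_distrib, Finset.sum_sub_distrib, Channel.sum_output]
  ring

end Protocol

/-! ### Bounded domains: one spiked alternative. -/

section SmallAlphabet

variable {k n : ℕ} [NeZero k] {Y : Type} [Fintype Y] {𝒲 : Set (Channel k Y)}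

/-- The mixture of the uniform distribution and a point mass. -/
noncomputable def spike (k : ℕ) [NeZero k] (x₀ : Fin k) (t : ℝ) (h0 : 0 ≤ t) (h1 : t ≤ 1) :
    Dist k :=
  ⟨fun x => (1 - t) * (1 / k) + t * if x = x₀ then 1 else 0, fun x => by
    have : 0 ≤ 1 - t := sub_nonneg.2 h1
    dsimp only
    positivity, by
    have : (k : ℝ) ≠ 0 := Nat.cast_ne_zero.mpr (NeZero.ne k)
    simp [Finset.sum_add_distrib]
    field_simp
    ring⟩

lemma tvDist_spike (x₀ : Fin k) {t : ℝ} (h0 : 0 ≤ t) (h1 : t ≤ 1) :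
    tvDist (spike k x₀ t h0 h1) (uniform k) = t * (1 - 1 / k) := by
  have hk : (k : ℝ) ≠ 0 := Nat.cast_ne_zero.mpr (NeZero.ne k)
  have hk1 : (1 : ℝ) ≤ k := Nat.one_le_cast.2 (NeZero.one_le)
  have hk2 : 1 / (k : ℝ) ≤ 1 := by rw [div_le_one (by positivity)]; exact hk1
  have h : ∀ x, |spike k x₀ t h0 h1 x - uniform k x| =
      t / k + if x = x₀ then t * (1 - 2 / k) else 0 := by
    intro x
    change |(1 - t) * (1 / k) + t * (if x = x₀ then 1 else 0) - 1 / k| = _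
    split_ifs
    · rw [show (1 - t) * (1 / (k : ℝ)) + t * 1 - 1 / k = t * (1 - 1 / k) by ring, abs_of_nonneg
        (mul_nonneg h0 (sub_nonneg.2 hk2))]
      ring
    · rw [show (1 - t) * (1 / (k : ℝ)) + t * 0 - 1 / k = -(t / k) by ring, abs_neg,
        abs_of_nonneg (by positivity), add_zero]
  rw [tvDist, Finset.sum_congr rfl fun x _ => h x, Finset.sum_add_distrib]
  simp
  field_simp
  ring

lemma Channel.output_spike_sub (W : Channel k Y) (x₀ : Fin k) {t : ℝ} (h0 : 0 ≤ t) (h1 : t ≤ 1)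
    (y : Y) : W.output (spike k x₀ t h0 h1) y - W.output (uniform k) y =
      t * (W x₀ y - W.output (uniform k) y) := by
  have : W.output (spike k x₀ t h0 h1) y = (1 - t) * W.output (uniform k) y + t * W x₀ y := by
    simp only [Channel.output]
    rw [Finset.mul_sum]
    have e : ∀ x, spike k x₀ t h0 h1 x * W x y = (1 - t) * (uniform k x * W x y) +
        if x = x₀ then t * W x₀ y else 0 := by
      intro x
      change ((1 - t) * (1 / k) + t * if x = x₀ then 1 else 0) * W x y =
        (1 - t) * (1 / k * W x y) + _
      split_ifs with hx
      · subst hx; ring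
      · ring
    rw [Finset.sum_congr rfl fun x _ => e x, Finset.sum_add_distrib]
    simp
  rw [this]; ring

/-- Uses `W x₀ y ≤ k * W.output (uniform k) y`: one input accounts for at most the total over all
inputs. -/
lemma Channel.chiSq_spike_le (W : Channel k Y) (x₀ : Fin k) {t : ℝ} (h0 : 0 ≤ t) (h1 : t ≤ 1) :
    ∑ y, W.output (spike k x₀ t h0 h1) y * W.output (spike k x₀ t h0 h1) y /
      W.output (uniform k) y ≤ 1 + t ^ 2 * k := by
  rw [Channel.sum_output_mul_output_div]
  simp only [Channel.output_spike_sub]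
  have hk : (0 : ℝ) < k := Nat.cast_pos.2 (NeZero.pos k)
  have h : ∀ y, t * (W x₀ y - W.output (uniform k) y) * (t * (W x₀ y - W.output (uniform k) y)) /
      W.output (uniform k) y ≤ t ^ 2 * (k * W x₀ y - 2 * W x₀ y + W.output (uniform k) y) := by
    intro y
    by_cases hy : W.output (uniform k) y = 0
    · have := Channel.output_eq_zero_of_uniform hy (spike k x₀ 1 zero_le_one le_rfl)
      have h2 := Channel.output_spike_sub W x₀ zero_le_one le_rfl y
      have h3 : W x₀ y = 0 := by rw [this, hy] at h2; linarith
      simp [hy, h3]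
    have hpos : 0 < W.output (uniform k) y :=
      lt_of_le_of_ne (Channel.output_nonneg _ _ _) (Ne.symm hy)
    have hw : 0 ≤ W x₀ y := (W x₀).2.1 y
    have hle : W x₀ y ≤ k * W.output (uniform k) y := by
      rw [Channel.output_uniform, mul_div_cancel₀ _ hk.ne']
      exact Finset.single_le_sum (f := fun x => W x y) (fun x _ => (W x).2.1 y)
        (Finset.mem_univ x₀)
    rw [div_le_iff₀ hpos]
    have : W x₀ y * W x₀ y ≤ W x₀ y * (k * W.output (uniform k) y) :=
      mul_le_mul_of_nonneg_left hle hw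
    nlinarith [mul_nonneg (sq_nonneg t) (sub_nonneg.2 this)]
  have hW : ∑ y, W x₀ y = 1 := (W x₀).2.2
  have hs := Finset.sum_le_sum fun y (_ : y ∈ Finset.univ) => h y
  rw [← Finset.mul_sum, Finset.sum_add_distrib, Finset.sum_sub_distrib, ← Finset.mul_sum,
    ← Finset.mul_sum, hW, Channel.sum_output] at hs
  nlinarith [sq_nonneg t]

/-- A lower bound on the number of players from a single alternative. -/
theorem PrivateCoinProtocol.IsIdentityTest.lt_mul_sq {P : PrivateCoinProtocol.{u} 𝒲 n}
    {T : (Fin n → Y) → Set.Icc (0 : ℝ) 1} {ε : ℝ} (h : P.IsIdentityTest T (uniform k) ε)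
    (hε : 0 < ε) (hεk : ε < 1 - 1 / (k : ℝ)) : 1 / 4 < n * (9 * ε ^ 2 * k) := by
  by_contra! hn
  have hk : (0 : ℝ) < k := Nat.cast_pos.2 (NeZero.pos k)
  have hk2 : (2 : ℝ) ≤ k := by
    have h1 : 1 < k := by
      by_contra! h1
      have : k = 1 := le_antisymm h1 NeZero.one_le
      subst this
      norm_num at hεk
      linarith
    exact_mod_cast h1
  have hk3 : 1 / (k : ℝ) ≤ 1 / 2 := one_div_le_one_div_of_le two_pos hk2
  -- The spike is at distance `t (1 - 1/k)`. The factor 3 beats `1 - 1/k ≥ 1/2`; when the minimum is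
  -- 1, the hypothesis `ε < 1 - 1/k` is exactly what is needed.
  set t := min 1 (3 * ε)
  have ht0 : 0 ≤ t := le_min zero_le_one (by linarith)
  have ht1 : t ≤ 1 := min_le_left _ _
  have ht3 : t ≤ 3 * ε := min_le_right _ _
  have htv : ε < t * (1 - 1 / k) := by
    rcases min_choice 1 (3 * ε) with h | h
    · simp only [t, h]; linarith
    · simp only [t, h]; nlinarith
  set p := spike k 0 t ht0 ht1
  have key := h.lt_chiSq_mixture (Ω := Unit) (w := fun _ => 1) (p := fun _ => p)
    (fun _ => zero_le_one) (by simp) (fun _ _ => by rw [tvDist_spike]; exact htv)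
    (fun i y _ hy => Channel.output_eq_zero_of_uniform hy p)
  simp only [Finset.univ_unique, Finset.sum_singleton, mul_one, one_mul] at key
  have h2 : ∏ i, ∑ y, (P.avgChannel i).output p y * (P.avgChannel i).output p y /
      (P.avgChannel i).output (uniform k) y ≤ Real.exp (1 / 4) := by
    calc _ ≤ ∏ i : Fin n, Real.exp (t ^ 2 * k) := by
          refine Finset.prod_le_prod (fun i _ => Finset.sum_nonneg fun y _ => ?_) fun i _ => ?_
          · exact div_nonneg (mul_nonneg (Channel.output_nonneg _ _ _)
              (Channel.output_nonneg _ _ _)) (Channel.output_nonneg _ _ _)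
          · refine (Channel.chiSq_spike_le _ _ ht0 ht1).trans ?_
            rw [add_comm]
            exact Real.add_one_le_exp _
      _ = Real.exp (n * (t ^ 2 * k)) := by
          rw [Finset.prod_const, Finset.card_univ, Fintype.card_fin, ← Real.exp_nat_mul]
      _ ≤ _ := by
          refine Real.exp_le_exp.2 (le_trans ?_ hn)
          have : t ^ 2 ≤ 9 * ε ^ 2 := by nlinarith
          gcongr
  have h3 : Real.exp (1 / 4) ≤ 25 / 16 := by
    have e : Real.exp (1 / 4) = Real.exp (1 / 8) * Real.exp (1 / 8) := by
      rw [← Real.exp_add]; norm_num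
    have := exp_inv_eight_le
    rw [e]
    nlinarith [Real.exp_pos (1 / 8)]
  linarith

end SmallAlphabet

/-! ### Large domains: tilted distributions and channel influences. -/

section LargeAlphabet

variable {k n : ℕ} [NeZero k] {Y : Type} [Fintype Y] {𝒲 : Set (Channel k Y)}

/-- The distribution whose density relative to the uniform one is proportional to `1 + s f`. -/
noncomputable def tilt (f : Fin k → ℝ) (s : ℝ) (hf : ∀ x, 0 ≤ 1 + s * f x)
    (hs : 0 < ∑ x, (1 + s * f x)) : Dist k :=
  ⟨fun x => (1 + s * f x) / ∑ x, (1 + s * f x), fun x => div_nonneg (hf x) hs.le, by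
    rw [← Finset.sum_div]; exact div_self hs.ne'⟩

lemma sum_one_add_mul {k : ℕ} (f : Fin k → ℝ) (s : ℝ) :
    ∑ x, (1 + s * f x) = k + s * ∑ x, f x := by
  simp [Finset.sum_add_distrib, Finset.mul_sum]

lemma Channel.output_tilt_sub (W : Channel k Y) {f : Fin k → ℝ} {s : ℝ}
    (hf : ∀ x, 0 ≤ 1 + s * f x) (hs : 0 < ∑ x, (1 + s * f x)) (y : Y) :
    W.output (tilt f s hf hs) y - W.output (uniform k) y =
      s / (∑ x, (1 + s * f x)) * ∑ x, f x * (W x y - (∑ z, W z y) / k) := by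
  have hk : (k : ℝ) ≠ 0 := Nat.cast_ne_zero.mpr (NeZero.ne k)
  have h1 : W.output (tilt f s hf hs) y =
      (∑ x, W x y + s * ∑ x, f x * W x y) / ∑ x, (1 + s * f x) := by
    rw [Channel.output, Finset.mul_sum, ← Finset.sum_add_distrib, Finset.sum_div]
    refine Finset.sum_congr rfl fun x _ => ?_
    change (1 + s * f x) / (∑ x, (1 + s * f x)) * W x y = _
    ring
  have h2 : ∑ x, f x * (W x y - (∑ z, W z y) / k) =
      ∑ x, f x * W x y - (∑ x, f x) * (∑ z, W z y) / k := by
    simp only [mul_sub, Finset.sum_sub_distrib, ← Finset.sum_mul, mul_div_assoc]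
  rw [h1, h2, Channel.output_uniform]
  rw [sum_one_add_mul] at hs ⊢
  have := hs.ne'
  field_simp
  ring

/-- Only the points with `f x = -1` are counted: each lacks at least `s (1 - 2a) / k` of its uniform
mass, so the distance is at least `s (1 - 2a)²`. -/
lemma lt_tvDist_tilt {f : Fin k → ℝ} {s a : ℝ} (hf : ∀ x, 0 ≤ 1 + s * f x)
    (hs : 0 < ∑ x, (1 + s * f x)) (hs0 : 0 < s) (hs1 : s ≤ 1) (ha : 0 < a) (ha1 : a ≤ 1 / 10)
    (hm : |∑ x, f x| ≤ a * k)
    (hc : (1 - 2 * a) * k ≤ (Finset.univ.filter fun x => f x = -1).card) :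
    s * (1 - 10 * a) < tvDist (tilt f s hf hs) (uniform k) := by
  have hk : (0 : ℝ) < k := Nat.cast_pos.2 (NeZero.pos k)
  set N := ∑ x, (1 + s * f x)
  have hN : N = k + s * ∑ x, f x := sum_one_add_mul f s
  obtain ⟨hm1, hm2⟩ := abs_le.1 hm
  set p := tilt f s hf hs
  have h1 : ∀ x, (uniform k x - p x) + |p x - uniform k x| ≥ 0 := fun x => by
    have := le_abs_self (p x - uniform k x); linarith
  have h2 : ∀ x, f x = -1 → (uniform k x - p x) + |p x - uniform k x| ≥
      2 * (1 / k - (1 - s) / N) := by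
    intro x hx
    have := neg_abs_le (p x - uniform k x)
    have e1 : p x = (1 - s) / N := by
      change (1 + s * f x) / N = _
      rw [hx]; ring
    have e2 : uniform k x = 1 / (k : ℝ) := rfl
    have e3 : 1 / (k : ℝ) - (1 - s) / N = uniform k x - p x := by rw [e1, e2]
    rw [e3]
    linarith
  have h3 : ∑ x, ((uniform k x - p x) + |p x - uniform k x|) = 2 * tvDist p (uniform k) := by
    have e1 : ∑ x, p x = 1 := p.2.2
    have e2 : ∑ x, uniform k x = 1 := (uniform k).2.2
    rw [Finset.sum_add_distrib, Finset.sum_sub_distrib, e1, e2, tvDist]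
    ring
  have h4 : (Finset.univ.filter fun x => f x = -1).card * (2 * (1 / k - (1 - s) / N)) ≤
      2 * tvDist p (uniform k) := by
    rw [← h3, ← nsmul_eq_mul, ← Finset.sum_const]
    refine (Finset.sum_le_sum fun x hx => h2 x (Finset.mem_filter.1 hx).2).trans ?_
    exact Finset.sum_le_sum_of_subset_of_nonneg (Finset.filter_subset _ _) fun x _ _ => h1 x
  have hlo : k * s * (1 - a) ≤ N - k * (1 - s) := by rw [hN]; nlinarith
  have hhi : N ≤ k * (1 + a) := by
    rw [hN]
    have : s * ∑ x, f x ≤ 1 * (a * k) := by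
      refine (mul_le_mul_of_nonneg_left hm2 hs0.le).trans ?_
      exact mul_le_mul_of_nonneg_right hs1 (by positivity)
    linarith
  have h5 : s * (1 - 2 * a) / k ≤ 1 / k - (1 - s) / N := by
    rw [div_sub_div _ _ hk.ne' hs.ne', div_le_div_iff₀ hk (by positivity)]
    have e : s * (1 - 2 * a) * N ≤ s * (1 - a) * k := by
      calc s * (1 - 2 * a) * N ≤ s * (1 - 2 * a) * (k * (1 + a)) := by
            refine mul_le_mul_of_nonneg_left hhi (mul_nonneg hs0.le (by linarith))
        _ = s * k * ((1 - 2 * a) * (1 + a)) := by ring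
        _ ≤ s * k * (1 - a) := by
            refine mul_le_mul_of_nonneg_left ?_ (by positivity)
            nlinarith
        _ = _ := by ring
    nlinarith
  have h6 : s * (1 - 2 * a) * (1 - 2 * a) ≤ tvDist p (uniform k) := by
    have h7 : 0 ≤ s * (1 - 2 * a) / k := div_nonneg (mul_nonneg hs0.le (by linarith)) hk.le
    have h8 : (1 - 2 * a) * k * (s * (1 - 2 * a) / k) ≤
        (Finset.univ.filter fun x => f x = -1).card * (1 / k - (1 - s) / N) :=
      mul_le_mul hc h5 h7 (Nat.cast_nonneg _)
    have h9 : (1 - 2 * a) * k * (s * (1 - 2 * a) / k) = s * (1 - 2 * a) * (1 - 2 * a) := by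
      field_simp
    linarith
  refine lt_of_lt_of_le ?_ h6
  rw [mul_assoc]
  refine mul_lt_mul_of_pos_left ?_ hs0
  nlinarith

/-- The vector of normalized deviations of the channels `V` at input `x`. -/
noncomputable def influence {k : ℕ} (V : Fin n → Channel k Y) (x : Fin k) :
    EuclideanSpace ℝ (Fin n × Y) :=
  WithLp.toLp 2 fun j => (V j.1 x j.2 - (∑ z, V j.1 z j.2) / k) / √(k * ∑ z, V j.1 z j.2)

lemma inner_sum_influence {k : ℕ} (V : Fin n → Channel k Y) (f g : Fin k → ℝ) :
    inner ℝ (∑ x, f x • influence V x) (∑ x, g x • influence V x) =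
      ∑ i, ∑ y, (∑ x, f x * (V i x y - (∑ z, V i z y) / k)) *
        (∑ x, g x * (V i x y - (∑ z, V i z y) / k)) / (k * ∑ z, V i z y) := by
  have hc : ∀ (f : Fin k → ℝ) (j : Fin n × Y), (∑ x, f x • influence V x) j =
      (∑ x, f x * (V j.1 x j.2 - (∑ z, V j.1 z j.2) / k)) / √(k * ∑ z, V j.1 z j.2) := by
    intro f j
    rw [WithLp.ofLp_sum, Finset.sum_apply, Finset.sum_div]
    refine Finset.sum_congr rfl fun x _ => ?_
    simp [influence, mul_div_assoc]
  rw [PiLp.inner_apply, Fintype.sum_prod_type]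
  refine Finset.sum_congr rfl fun i _ => Finset.sum_congr rfl fun y _ => ?_
  rw [hc, hc]
  have h0 : 0 ≤ k * ∑ z, V i z y :=
    mul_nonneg (Nat.cast_nonneg _) (Finset.sum_nonneg fun z _ => (V i z).2.1 y)
  simp only [RCLike.inner_apply, conj_trivial]
  rw [div_mul_div_comm, Real.mul_self_sqrt h0, mul_comm]

/-- Each pair of a player and a message contributes at most `1/k`, because probabilities satisfy `V²
≤ V`. This is where the alphabet size enters. -/
lemma sum_norm_influence_sq_le (V : Fin n → Channel k Y) :
    ∑ x, ‖influence V x‖ ^ 2 ≤ n * Fintype.card Y / k := by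
  have hk : (0 : ℝ) < k := Nat.cast_pos.2 (NeZero.pos k)
  have h1 : ∀ x, ‖influence V x‖ ^ 2 =
      ∑ i, ∑ y, (V i x y - (∑ z, V i z y) / k) ^ 2 / (k * ∑ z, V i z y) := by
    intro x
    rw [EuclideanSpace.norm_sq_eq, Fintype.sum_prod_type]
    refine Finset.sum_congr rfl fun i _ => Finset.sum_congr rfl fun y _ => ?_
    have h0 : 0 ≤ k * ∑ z, V i z y :=
      mul_nonneg (Nat.cast_nonneg _) (Finset.sum_nonneg fun z _ => (V i z).2.1 y)
    change ‖(V i x y - (∑ z, V i z y) / k) / √(k * ∑ z, V i z y)‖ ^ 2 = _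
    rw [Real.norm_eq_abs, sq_abs, div_pow, Real.sq_sqrt h0]
  have h2 : ∀ i y, ∑ x, (V i x y - (∑ z, V i z y) / k) ^ 2 / (k * ∑ z, V i z y) ≤ 1 / (k : ℝ) := by
    intro i y
    set S := ∑ z, V i z y with hS
    have hS0 : 0 ≤ S := Finset.sum_nonneg fun z _ => (V i z).2.1 y
    rcases hS0.eq_or_lt with h0 | h0
    · rw [← h0]; simp
    rw [← Finset.sum_div, div_le_div_iff₀ (by positivity) hk, one_mul, mul_comm]
    refine mul_le_mul_of_nonneg_left ?_ hk.le
    have e : ∀ x, (V i x y - S / k) ^ 2 ≤ V i x y - 2 * (S / k) * V i x y + (S / k) ^ 2 := by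
      intro x
      have hx0 : 0 ≤ V i x y := (V i x).2.1 y
      have hx1 : V i x y ≤ 1 := by
        have : ∑ z, V i x z = 1 := (V i x).2.2
        rw [← this]
        exact Finset.single_le_sum (f := fun z => V i x z) (fun z _ => (V i x).2.1 z)
          (Finset.mem_univ y)
      nlinarith
    refine (Finset.sum_le_sum fun x _ => e x).trans ?_
    rw [Finset.sum_add_distrib, Finset.sum_sub_distrib, ← Finset.mul_sum, ← hS]
    simp only [Finset.sum_const, Finset.card_univ, Fintype.card_fin, nsmul_eq_mul]
    have : 2 * (S / k) * S - k * (S / k) ^ 2 = S ^ 2 / k := by field_simp; ring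
    have : 0 ≤ S ^ 2 / k := by positivity
    linarith
  simp only [h1]
  calc _ = ∑ i, ∑ y, ∑ x, (V i x y - (∑ z, V i z y) / k) ^ 2 / (k * ∑ z, V i z y) := by
        rw [Finset.sum_comm]
        exact Finset.sum_congr rfl fun i _ => Finset.sum_comm
    _ ≤ ∑ i : Fin n, ∑ y : Y, 1 / (k : ℝ) :=
        Finset.sum_le_sum fun i _ => Finset.sum_le_sum fun y _ => h2 i y
    _ = _ := by
        simp only [Finset.sum_const, Finset.card_univ, Fintype.card_fin, nsmul_eq_mul]
        ring

/-- Each player's factor is 1 plus a bilinear term; `1 + t ≤ exp t` turns the product over players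
into one inner product of stacked vectors. -/
lemma prod_chiSq_tilt_le (V : Fin n → Channel k Y) {f g : Fin k → ℝ} {s : ℝ}
    (hf : ∀ x, 0 ≤ 1 + s * f x) (hfs : 0 < ∑ x, (1 + s * f x))
    (hg : ∀ x, 0 ≤ 1 + s * g x) (hgs : 0 < ∑ x, (1 + s * g x)) :
    ∏ i, ∑ y, (V i).output (tilt f s hf hfs) y * (V i).output (tilt g s hg hgs) y /
        (V i).output (uniform k) y ≤
      Real.exp (s ^ 2 * k ^ 2 / ((∑ x, (1 + s * f x)) * ∑ x, (1 + s * g x)) *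
        inner ℝ (∑ x, f x • influence V x) (∑ x, g x • influence V x)) := by
  have hk : (k : ℝ) ≠ 0 := Nat.cast_ne_zero.mpr (NeZero.ne k)
  rw [inner_sum_influence, Finset.mul_sum, Real.exp_sum]
  refine Finset.prod_le_prod (fun i _ => Finset.sum_nonneg fun y _ => ?_) fun i _ => ?_
  · exact div_nonneg (mul_nonneg (Channel.output_nonneg _ _ _)
      (Channel.output_nonneg _ _ _)) (Channel.output_nonneg _ _ _)
  rw [Channel.sum_output_mul_output_div, add_comm]
  refine le_trans (le_of_eq ?_) (Real.add_one_le_exp _)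
  rw [Finset.mul_sum]
  congr 1
  refine Finset.sum_congr rfl fun y _ => ?_
  rw [Channel.output_tilt_sub, Channel.output_tilt_sub, Channel.output_uniform]
  have h1 := hfs.ne'
  have h2 := hgs.ne'
  by_cases h0 : ∑ x, V i x y = 0
  · simp [h0]
  generalize ∑ x, (1 + s * f x) = A at *
  generalize ∑ x, (1 + s * g x) = B at *
  generalize ∑ x, f x * (V i x y - (∑ z, V i z y) / k) = C at *
  generalize ∑ x, g x * (V i x y - (∑ z, V i z y) / k) = D at *
  field_simp

/-- Bernoulli's inequality for the eighth power. It reduces the moment bound 5 to an excess of `(5 -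
1) / 8 = 1/2`, below the threshold `25/36`. -/
lemma exp_sub_one_le_of_eight_mul_le {t u : ℝ} (h : 8 * t ≤ u) :
    Real.exp t ≤ 1 + (Real.exp u - 1) / 8 := by
  have h1 := one_add_mul_le_pow (a := Real.exp t - 1) (by linarith [Real.exp_pos t]) 8
  rw [add_sub_cancel, ← Real.exp_nat_mul] at h1
  have h2 : Real.exp ((8 : ℕ) * t) ≤ Real.exp u := Real.exp_le_exp.2 (by push_cast; exact h)
  push_cast at h1 h2
  linarith

/-- The lower bound on the number of players for large domains. -/
theorem PrivateCoinProtocol.IsIdentityTest.le_of_large {P : PrivateCoinProtocol.{u} 𝒲 n}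
    {T : (Fin n → Y) → Set.Icc (0 : ℝ) 1} {ε : ℝ} (h : P.IsIdentityTest T (uniform k) ε)
    {a ε₁ c : ℝ} (ha : 0 < a) (ha1 : a ≤ 1 / 10) (hk : 16 ≤ a ^ 4 * k) (hε₁ : 0 < ε₁)
    (hε₁a : ε₁ ≤ 1 - 10 * a) (hε : 0 < ε) (hεε₁ : ε ≤ ε₁) (hc0 : 0 < c)
    (hc : c ≤ ε₁ ^ 2 * a ^ 3 / 256) :
    c * (√k * k) ≤ n * Fintype.card Y * ε ^ 2 := by
  by_contra! hn
  have hk0 : (0 : ℝ) < k := Nat.cast_pos.2 (NeZero.pos k)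
  set q := √(k : ℝ)
  have hq0 : 0 < q := Real.sqrt_pos.2 hk0
  have hq : q ^ 2 = k := Real.sq_sqrt hk0.le
  set V := P.avgChannel
  -- The largest scaling for which the negated bound `hn` still gives the norm budget `a k / 2` of
  -- `exists_hard_family`.
  set β := √(a * q * ε ^ 2 / (2 * c))
  have hβ : β ^ 2 = a * q * ε ^ 2 / (2 * c) := Real.sq_sqrt (by positivity)
  have hβ0 : 0 < β ^ 2 := by rw [hβ]; positivity
  have hr : ∑ x, ‖β • influence V x‖ ^ 2 ≤ a * k / 2 := by
    simp only [norm_smul, mul_pow, Real.norm_eq_abs, sq_abs]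
    rw [← Finset.mul_sum, hβ]
    refine (mul_le_mul_of_nonneg_left (sum_norm_influence_sq_le V) (by positivity)).trans ?_
    rw [div_mul_div_comm, div_le_div_iff₀ (by positivity) two_pos]
    have := mul_le_mul_of_nonneg_left hn.le (by positivity : 0 ≤ a * q * 2)
    calc _ = a * q * 2 * (n * Fintype.card Y * ε ^ 2) := by ring
      _ ≤ _ := this
      _ = a * 2 * c * k * q ^ 2 := by ring
      _ = _ := by rw [hq]; ring
  obtain ⟨Ω, hΩ, w, f, hw, hw1, hf, hm, hcard, hexp⟩ := exists_hard_family ha ha1 hk _ hr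
  set s := ε / ε₁
  have hs0 : 0 < s := by positivity
  have hs1 : s ≤ 1 := div_le_one_of_le₀ hεε₁ hε₁.le
  -- Outcomes of weight zero carry no bound on the sum of `f`, yet `tilt` needs a positive
  -- normalizer for every outcome.
  set f' : Ω → Fin k → ℝ := fun ω => if w ω = 0 then 0 else f ω
  have hff : ∀ ω, w ω ≠ 0 → f' ω = f ω := fun ω hω => by simp [f', hω]
  have hpos : ∀ ω x, 0 ≤ 1 + s * f' ω x := by
    intro ω x
    by_cases hω : w ω = 0
    · simp [f', hω]
    · rw [hff ω hω]; nlinarith [hf ω x]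
  have hN : ∀ ω, 9 / 10 * k ≤ ∑ x, (1 + s * f' ω x) := by
    intro ω
    rw [sum_one_add_mul]
    by_cases hω : w ω = 0
    · simp only [f', hω, if_true, Pi.zero_apply, Finset.sum_const_zero, mul_zero]
      linarith
    · rw [hff ω hω]
      have h1 := (abs_le.1 (hm ω hω)).1
      have h2 : s * (-(a * k)) ≤ s * ∑ x, f ω x := mul_le_mul_of_nonneg_left h1 hs0.le
      have h3 : s * (a * k) ≤ 1 * (1 / 10 * k) := by gcongr
      linarith
  have hN0 : ∀ ω, 0 < ∑ x, (1 + s * f' ω x) := fun ω => lt_of_lt_of_le (by positivity) (hN ω)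
  have key := h.lt_chiSq_mixture hw hw1 (p := fun ω => tilt (f' ω) s (hpos ω) (hN0 ω))
    (fun ω hω => by
      refine lt_of_le_of_lt ?_ (lt_tvDist_tilt (hpos ω) (hN0 ω) hs0 hs1 ha ha1
        (by rw [hff ω hω]; exact hm ω hω) (by rw [hff ω hω]; exact hcard ω hω))
      calc ε = s * ε₁ := (div_mul_cancel₀ _ hε₁.ne').symm
        _ ≤ _ := mul_le_mul_of_nonneg_left hε₁a hs0.le)
    (fun i y ω hy => Channel.output_eq_zero_of_uniform hy _)
  -- Here `16 = 8 * 2`: the 8 is for Bernoulli and the 2 bounds `k²` over the product of the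
  -- normalizers. `β²` undoes the rescaling.
  set M := 16 * s ^ 2 / β ^ 2
  have hM : 40 * k * M ^ 2 ≤ a ^ 4 := by
    have e1 : M = 32 * c / (ε₁ ^ 2 * a * q) := by
      simp only [M, s, hβ]
      field_simp
      norm_num
    have e2 : 32 * c ≤ ε₁ ^ 2 * a ^ 3 / 8 := by linarith
    have e3 : M * q ≤ a ^ 2 / 8 := by
      rw [e1, div_mul_eq_mul_div, div_le_iff₀ (by positivity)]
      calc 32 * c * q ≤ ε₁ ^ 2 * a ^ 3 / 8 * q := mul_le_mul_of_nonneg_right e2 hq0.le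
        _ = _ := by ring
    have e4 : (M * q) ^ 2 ≤ (a ^ 2 / 8) ^ 2 := pow_le_pow_left₀ (by positivity) e3 2
    calc 40 * k * M ^ 2 = 40 * (M * q) ^ 2 := by rw [← hq]; ring
      _ ≤ 40 * (a ^ 2 / 8) ^ 2 := by gcongr
      _ ≤ a ^ 4 := by nlinarith [pow_pos ha 4]
  have hE := hexp M hM
  have hterm : ∀ ω ω', w ω * w ω' * ∏ i, ∑ y,
      (P.avgChannel i).output (tilt (f' ω) s (hpos ω) (hN0 ω)) y *
      (P.avgChannel i).output (tilt (f' ω') s (hpos ω') (hN0 ω')) y /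
      (P.avgChannel i).output (uniform k) y ≤ 7 / 8 * (w ω * w ω') + 1 / 8 * (w ω * w ω' *
        Real.exp |M * inner ℝ (∑ x, f ω x • β • influence V x)
          (∑ x, f ω' x • β • influence V x)|) := by
    intro ω ω'
    by_cases h0 : w ω = 0
    · simp [h0]
    by_cases h0' : w ω' = 0
    · simp [h0']
    have hww := mul_nonneg (hw ω) (hw ω')
    refine (mul_le_mul_of_nonneg_left (prod_chiSq_tilt_le V (hpos ω) (hN0 ω) (hpos ω') (hN0 ω'))
      hww).trans ?_
    have hin : inner ℝ (∑ x, f ω x • β • influence V x) (∑ x, f ω' x • β • influence V x) =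
        β ^ 2 * inner ℝ (∑ x, f ω x • influence V x) (∑ x, f ω' x • influence V x) := by
      simp only [smul_comm _ β, ← Finset.smul_sum, inner_smul_left, inner_smul_right,
        conj_trivial]
      ring
    rw [hin]
    have hle : 8 * (s ^ 2 * k ^ 2 / ((∑ x, (1 + s * f' ω x)) * ∑ x, (1 + s * f' ω' x)) *
        inner ℝ (∑ x, f' ω x • influence V x) (∑ x, f' ω' x • influence V x)) ≤
        |M * (β ^ 2 * inner ℝ (∑ x, f ω x • influence V x) (∑ x, f ω' x • influence V x))| := by
      have hMβ : M * β ^ 2 = 16 * s ^ 2 := div_mul_cancel₀ _ hβ0.ne'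
      have hNN : k ^ 2 / ((∑ x, (1 + s * f' ω x)) * ∑ x, (1 + s * f' ω' x)) ≤ 2 := by
        rw [div_le_iff₀ (mul_pos (hN0 ω) (hN0 ω'))]
        have := mul_le_mul (hN ω) (hN ω') (by positivity) (hN0 ω).le
        nlinarith [sq_nonneg (k : ℝ)]
      have hNN0 : 0 ≤ k ^ 2 / ((∑ x, (1 + s * f' ω x)) * ∑ x, (1 + s * f' ω' x)) :=
        div_nonneg (sq_nonneg _) (mul_pos (hN0 ω) (hN0 ω')).le
      rw [← mul_assoc M, hMβ, abs_mul, abs_of_nonneg (by positivity : 0 ≤ 16 * s ^ 2),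
        ← hff ω h0, ← hff ω' h0', mul_div_assoc]
      generalize k ^ 2 / ((∑ x, (1 + s * f' ω x)) * ∑ x, (1 + s * f' ω' x)) = N at *
      set I : ℝ := inner ℝ (∑ x, f' ω x • influence V x) (∑ x, f' ω' x • influence V x)
      calc 8 * (s ^ 2 * N * I) ≤ 8 * (s ^ 2 * N * |I|) := by
            have := le_abs_self I
            gcongr
        _ ≤ 8 * (s ^ 2 * 2 * |I|) := by gcongr
        _ = _ := by ring
    have := mul_le_mul_of_nonneg_left (exp_sub_one_le_of_eight_mul_le hle) hww
    linarith
  have hww1 : ∑ ω, ∑ ω', w ω * w ω' = 1 := by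
    rw [← Finset.sum_mul_sum, hw1, one_mul]
  have hfin := Finset.sum_le_sum fun ω (_ : ω ∈ Finset.univ) =>
    Finset.sum_le_sum fun ω' (_ : ω' ∈ Finset.univ) => hterm ω ω'
  simp only [Finset.sum_add_distrib, ← Finset.mul_sum (a := (1 / 8 : ℝ)),
    ← Finset.mul_sum (a := (7 / 8 : ℝ))] at hfin
  rw [hww1] at hfin
  linarith

end LargeAlphabet

end DistTesting

theorem mainTheorem7 (ε₁ : ℝ) (hε₁ : ε₁ < 1) :
    ∃ c : ℝ, 0 < c ∧ ∀ (k ℓ : ℕ) [NeZero k] (ε : ℝ), 0 < ε → ε ≤ ε₁ → ε < 1 - 1 / (k : ℝ) →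
      ENNReal.ofReal (c * ((k : ℝ) ^ (3 / 2 : ℝ) / (2 ^ ℓ * ε ^ 2))) ≤
        ((DistTesting.privateCoinUniformitySampleComplexity.{u}
          (DistTesting.bitChannels k ℓ) ε : ℕ∞) : ENNReal) := by
  rcases le_or_gt ε₁ 0 with h0 | h0
  · exact ⟨1, one_pos, fun k ℓ _ ε hε hεε₁ => absurd (hε.trans_le hεε₁) h0.not_gt⟩
  -- Then `1 - 10 a = ε₁`, so the tilt with `s = ε / ε₁` is farther than `ε` from uniform.
  set a := (1 - ε₁) / 10
  have ha : 0 < a := by simp only [a]; linarith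
  have ha1 : a ≤ 1 / 10 := by simp only [a]; linarith
  -- The size threshold of `exists_hard_family`; below it, `k ≤ K` lets the constant `1 / (36 K³)`
  -- absorb all powers of `k`.
  set K := 16 / a ^ 4
  have hK : 0 < K := by positivity
  refine ⟨min (ε₁ ^ 2 * a ^ 3 / 256) (1 / (36 * K ^ 3)), lt_min (by positivity) (by positivity),
    fun k ℓ _ ε hε hεε₁ hεk => ?_⟩
  set c := min (ε₁ ^ 2 * a ^ 3 / 256) (1 / (36 * K ^ 3))
  have hc0 : 0 < c := lt_min (by positivity) (by positivity)
  have hk0 : (0 : ℝ) < k := Nat.cast_pos.2 (NeZero.pos k)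
  have hk1 : (1 : ℝ) ≤ k := Nat.one_le_cast.2 NeZero.one_le
  have hpow : (k : ℝ) ^ (3 / 2 : ℝ) = √k * k := by
    rw [show (3 / 2 : ℝ) = 1 / 2 + 1 by norm_num, Real.rpow_add hk0, Real.rpow_one,
      Real.sqrt_eq_rpow]
  have hmain : ∀ n : ℕ, n ∈ {n : ℕ | ∃ (P : DistTesting.PrivateCoinProtocol.{u}
      (DistTesting.bitChannels k ℓ) n) (T : (Fin n → Fin ℓ → Bool) → Set.Icc (0 : ℝ) 1),
      P.IsIdentityTest T (DistTesting.uniform k) ε} →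
      c * ((k : ℝ) ^ (3 / 2 : ℝ) / (2 ^ ℓ * ε ^ 2)) ≤ n := by
    rintro n ⟨P, T, h⟩
    rw [hpow, mul_div_assoc', div_le_iff₀ (by positivity)]
    rcases le_or_gt K k with hkK | hkK
    · have := h.le_of_large ha ha1 (by
        rw [div_le_iff₀ (by positivity)] at hkK; linarith) h0
        (by simp only [a]; linarith) hε hεε₁ hc0 (min_le_left _ _)
      simp only [Fintype.card_fun, Fintype.card_bool, Fintype.card_fin, Nat.cast_pow,
        Nat.cast_ofNat] at this
      linarith
    · have h1 := h.lt_mul_sq hε hεk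
      have hc : c * (36 * K ^ 3) ≤ 1 := by
        rw [← le_div_iff₀ (by positivity)]; exact min_le_right _ _
      have hsq : √(k : ℝ) ≤ k := Real.sqrt_le_iff.2 ⟨hk0.le, by nlinarith⟩
      have hle : c * (√k * k) * (36 * k) ≤ 1 := by
        calc c * (√k * k) * (36 * k) ≤ c * (k * k) * (36 * k) := by gcongr
          _ = c * (36 * (k : ℝ) ^ 3) := by ring
          _ ≤ c * (36 * K ^ 3) := by gcongr
          _ ≤ 1 := hc
      have h2 : c * (√k * k) ≤ n * ε ^ 2 := by
        have : c * (√k * k) * (36 * k) ≤ n * ε ^ 2 * (36 * k) := by linarith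
        exact le_of_mul_le_mul_right this (by positivity)
      refine h2.trans ?_
      have : (1 : ℝ) ≤ 2 ^ ℓ := one_le_pow₀ one_le_two
      have h3 : 0 ≤ n * ε ^ 2 := by positivity
      nlinarith
  calc _ ≤ ((⌈c * ((k : ℝ) ^ (3 / 2 : ℝ) / (2 ^ ℓ * ε ^ 2))⌉₊ : ℕ) : ENNReal) := by
        rw [← ENNReal.ofReal_natCast]
        exact ENNReal.ofReal_le_ofReal (Nat.le_ceil _)
    _ = (((⌈c * ((k : ℝ) ^ (3 / 2 : ℝ) / (2 ^ ℓ * ε ^ 2))⌉₊ : ℕ) : ℕ∞) : ENNReal) := by simp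
    _ ≤ _ := by
        refine ENat.toENNReal_le.2 (le_iInf₂ fun n hn => ?_)
        exact_mod_cast Nat.ceil_le.2 (hmain n hn)
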